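/- \textbf{Theorem (convergence towards a weak solution).} Let $\phi\in C^1(\mathbb R)$ and $u^0\in L^\infty(\mathbb R)\cap BV(\mathbb R)$. Put $\alpha=\operatorname{ess\,inf}u^0$, $\beta=\operatorname{ess\,sup}u^0$, $M=\max_{\alpha\le\xi\le\beta}|\phi'(\xi)|$. Let $s\in(0,1]$ and let $\lambda>0$ be fixed with $\lambda\ge M$. For $\Delta x>0$ put $\Delta t=\Delta x/\lambda$, $x_j=j\Delta x$ $(j\in\mathbb Z)$, $t^n=n\Delta t$ $(n\in\mathbb N)$. Define $(u_j^n,v_j^n)$ by $$u_j^0=\frac1{\Delta x}\int_{x_j}^{x_{j+1}}u^0(x)\,dx,\qquad v_j^0=\phi(u_j^0),$$ $$v_j^{n+1/2}=(1-s)v_j^n+s\,\phi(u_j^n),$$ $$u_j^{n+1}=\tfrac12(u_{j+1}^n+u_{j-1}^n)-\tfrac1{2\lambda}(v_{j+1}^{n+1/2}-v_{j-1}^{n+1/2}),\qquad v_j^{n+1}=\tfrac12(v_{j+1}^{n+1/2}+v_{j-1}^{n+1/2})-\tfrac\lambda2(u_{j+1}^n-u_{j-1}^n),$$ and let $u_\Delta,v_\Delta$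 be the functions on $[0,\infty)\times\mathbb R$ equal to $u_j^n$, respectively $v_j^n$, on $[t^n,t^{n+1})\times[x_j,x_{j+1})$. Then for every sequence of mesh sizes $\Delta x_k>0$ with $\Delta x_k\to0$ (and $\Delta t_k=\Delta x_k/\lambda$) there are a subsequence and functions $u,v\in L^\infty([0,\infty)\times\mathbb R)$ such that $u,v\in BV((0,T)\times\mathbb R)$ for all $T>0$ and, along this subsequence, $$u_\Delta\to u\quad\text{and}\quad v_\Delta\to v\qquad\text{in }L^1_{loc}([0,\infty)\times\mathbb R).$$ Moreover $v=\phi(u)$ almost everywhere, and $u$ is a weak solution on $[0,\infty)\times\mathbb R$ of $$\partial_tu+\partial_x\phi(u)=0,\qquad u(0,\cdot)=u^0,$$ that is, for every $\psi\in C_c^\infty([0,\infty)\times\mathbb R)$ (the restrictions to $[0,\infty)\times\mathbb R$ of functions in $C_c^\infty(\mathbb R^2)$), $$\int_0^\infty\!\!\int_{\mathbb R}\bigl(u\,\partial_t\psi+\phi(u)\,\partial_x\psi\bigr)\,dx\,dt+\int_{\mathbb R}u^0(x)\,\psi(0,x)\,dx=0.$$ Here, for an open set $\Omega\subset\mathbb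 R^n$, $BV(\Omega)$ is the set of $g\in L^1_{loc}(\Omega)$ with $$\sup\Bigl\{\int_\Omega g\,\operatorname{div}\varphi:\ \varphi\in C^1_c(\Omega;\mathbb R^n),\ \|\varphi\|_\infty\le1\Bigr\}<\infty.$$ -/

import Mathlib

open MeasureTheory Set Filter Topology
open scoped ContDiff

noncomputable section

namespace D1Q2

/-! ### Function spaces -/

/-- Total variation over an open set `Ω ⊆ ℝ`: the supremum of `∫_Ω g ψ'` over `ψ ∈ C¹_c(Ω)` with
`|ψ| ≤ 1`. -/
def totalVariation1 (Ω : Set ℝ) (g : ℝ → ℝ) : ENNReal :=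
  ⨆ ψ ∈ {ψ : ℝ → ℝ | ContDiff ℝ 1 ψ ∧ HasCompactSupport ψ ∧ tsupport ψ ⊆ Ω ∧ ∀ x, |ψ x| ≤ 1},
    ENNReal.ofReal (∫ x in Ω, g x * deriv ψ x)

/-- `BV(Ω)` for an open set `Ω ⊆ ℝ`: locally integrable functions of finite total variation. -/
def MemBV1 (Ω : Set ℝ) (g : ℝ → ℝ) : Prop :=
  LocallyIntegrableOn g Ω ∧ totalVariation1 Ω g < ⊤

/-- Partial derivative with respect to the first variable (time). -/
def partialT (f : ℝ × ℝ → ℝ) (p : ℝ × ℝ) : ℝ := fderiv ℝ f p (1, 0)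

/-- Partial derivative with respect to the second variable (space). -/
def partialX (f : ℝ × ℝ → ℝ) (p : ℝ × ℝ) : ℝ := fderiv ℝ f p (0, 1)

/-- The vector fields `(a, b) ∈ C¹_c(Ω; ℝ²)` whose Euclidean norm is everywhere at most one. -/
def testFields (Ω : Set (ℝ × ℝ)) : Set ((ℝ × ℝ → ℝ) × (ℝ × ℝ → ℝ)) :=
  {F | ContDiff ℝ 1 F.1 ∧ ContDiff ℝ 1 F.2 ∧
    HasCompactSupport F.1 ∧ HasCompactSupport F.2 ∧ tsupport F.1 ⊆ Ω ∧ tsupport F.2 ⊆ Ω ∧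
    ∀ p, F.1 p ^ 2 + F.2 p ^ 2 ≤ 1}

/-- Total variation over an open set `Ω ⊆ ℝ²`: the supremum of `∫_Ω g div F` over `testFields Ω`. -/
def totalVariation2 (Ω : Set (ℝ × ℝ)) (g : ℝ × ℝ → ℝ) : ENNReal :=
  ⨆ F ∈ testFields Ω, ENNReal.ofReal (∫ p in Ω, g p * (partialT F.1 p + partialX F.2 p))

/-- `BV(Ω)` for an open set `Ω ⊆ ℝ²`: locally integrable functions of finite total variation. -/
def MemBV2 (Ω : Set (ℝ × ℝ)) (g : ℝ × ℝ → ℝ) : Prop :=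
  LocallyIntegrableOn g Ω ∧ totalVariation2 Ω g < ⊤

/-- The closed half plane `[0, ∞) × ℝ` of points `(t, x)`. -/
def halfPlane : Set (ℝ × ℝ) := Ici 0 ×ˢ univ

/-- The open strip `(0, T) × ℝ` of points `(t, x)`. -/
def strip (T : ℝ) : Set (ℝ × ℝ) := Ioo 0 T ×ˢ univ

/-- Convergence in `L¹_loc(S)`: all functions belong to `L¹_loc(S)`, and `f k → g` in `L¹(K)` for
every compact `K ⊆ S`. -/
def TendstoL1Loc (f : ℕ → ℝ × ℝ → ℝ) (g : ℝ × ℝ → ℝ) (S : Set (ℝ × ℝ)) : Prop :=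
  (∀ k, LocallyIntegrableOn (f k) S) ∧ LocallyIntegrableOn g S ∧
    ∀ K : Set (ℝ × ℝ), IsCompact K → K ⊆ S →
      Tendsto (fun k => eLpNorm (f k - g) 1 (volume.restrict K)) atTop (𝓝 0)

/-- `u` is a bounded weak solution on `[0, ∞) × ℝ` of `∂ₜ u + ∂ₓ φ(u) = 0`, `u(0, ·) = u₀`.
The test functions need not vanish at `t = 0`. -/
def IsWeakSolution (φ u₀ : ℝ → ℝ) (u : ℝ × ℝ → ℝ) : Prop :=
  MemLp u ⊤ (volume.restrict halfPlane) ∧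
    ∀ ψ : ℝ × ℝ → ℝ, ContDiff ℝ ∞ ψ → HasCompactSupport ψ →
      (∫ p in halfPlane, (u p * partialT ψ p + φ (u p) * partialX ψ p)) +
        ∫ x, u₀ x * ψ (0, x) = 0

/-! ### The scheme -/

/-- `M = max |φ'|` over `[ess inf u₀, ess sup u₀]`. -/
def maxSpeed (φ u₀ : ℝ → ℝ) : ℝ :=
  sSup ((fun ξ => |deriv φ ξ|) '' Icc (essInf u₀ volume) (essSup u₀ volume))

/-- Initial moments: cell averages of `u₀`, with the second moment at equilibrium. -/
def initialMoments (φ u₀ : ℝ → ℝ) (dx : ℝ) (j : ℤ) : ℝ × ℝ :=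
  let a := (1 / dx) * ∫ x in (j * dx)..((j + 1) * dx), u₀ x
  (a, φ a)

/-- The second moment after the relaxation phase; `m j = (u_j, v_j)`. -/
def relaxedV (φ : ℝ → ℝ) (s : ℝ) (m : ℤ → ℝ × ℝ) (j : ℤ) : ℝ :=
  (1 - s) * (m j).2 + s * φ (m j).1

/-- One time step (relaxation, then transport) on the moments `m j = (u_j, v_j)`. -/
def schemeStep (φ : ℝ → ℝ) (lam s : ℝ) (m : ℤ → ℝ × ℝ) (j : ℤ) : ℝ × ℝ :=
  (((m (j + 1)).1 + (m (j - 1)).1) / 2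
      - (relaxedV φ s m (j + 1) - relaxedV φ s m (j - 1)) / (2 * lam),
    (relaxedV φ s m (j + 1) + relaxedV φ s m (j - 1)) / 2
      - lam / 2 * ((m (j + 1)).1 - (m (j - 1)).1))

/-- The moments `(u_j^n, v_j^n)` computed by the scheme. -/
def moments (φ u₀ : ℝ → ℝ) (lam s dx : ℝ) : ℕ → ℤ → ℝ × ℝ
  | 0 => initialMoments φ u₀ dx
  | n + 1 => schemeStep φ lam s (moments φ u₀ lam s dx n)

/-- The function on `ℝ²` equal to `w n j` on each cell `[n dt, (n+1) dt) × [j dx, (j+1) dx)`,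
`n ∈ ℕ`, `j ∈ ℤ`, and to `0` for `t < 0`. -/
def reconstruct (dt dx : ℝ) (w : ℕ → ℤ → ℝ) (p : ℝ × ℝ) : ℝ :=
  if 0 ≤ p.1 then w ⌊p.1 / dt⌋₊ ⌊p.2 / dx⌋ else 0

theorem reconstruct_eq {dt dx : ℝ} (hdt : 0 < dt) (hdx : 0 < dx) (w : ℕ → ℤ → ℝ)
    (n : ℕ) (j : ℤ) {t x : ℝ} (ht : t ∈ Ico (n * dt) ((n + 1) * dt))
    (hx : x ∈ Ico (j * dx) ((j + 1) * dx)) : reconstruct dt dx w (t, x) = w n j := by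
  have h0 : 0 ≤ t := le_trans (by positivity) ht.1
  have h1 : ⌊t / dt⌋₊ = n := by
    rw [Nat.floor_eq_iff (by positivity)]
    exact ⟨(le_div_iff₀ hdt).2 ht.1, (div_lt_iff₀ hdt).2 ht.2⟩
  have h2 : ⌊x / dx⌋ = j := by
    rw [Int.floor_eq_iff]
    exact ⟨(le_div_iff₀ hdx).2 hx.1, (div_lt_iff₀ hdx).2 hx.2⟩
  simp [reconstruct, h0, h1, h2]

/-- The reconstruction `u_Δ`, with time step `dt = dx / lam`. -/
def uDelta (φ u₀ : ℝ → ℝ) (lam s dx : ℝ) : ℝ × ℝ → ℝ :=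
  reconstruct (dx / lam) dx fun n j => (moments φ u₀ lam s dx n j).1

/-- The reconstruction `v_Δ`, with time step `dt = dx / lam`. -/
def vDelta (φ u₀ : ℝ → ℝ) (lam s dx : ℝ) : ℝ × ℝ → ℝ :=
  reconstruct (dx / lam) dx fun n j => (moments φ u₀ lam s dx n j).2

end D1Q2

end

open scoped ENNReal

noncomputable section

namespace D1Q2

/-! In the variables f± = u/2 ± v/(2λ) the scheme is a relaxation of f± towards the equilibria u/2 ±
φ(u)/(2λ), followed by a shift of f± by one cell to the right or left. The condition λ ≥ M says
exactly that both equilibria are nondecreasing functions of u on [α, β] (`monotoneOn_kineticEq`).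
Monotonicity yields an invariant region, hence uniform bounds, and makes one step an ℓ¹ contraction
in (f₊, f₋) (`tsum_kineticDist_schemeStep_le`).

Comparing the solution with its translates by one cell and by one time step, the contraction bounds
the variation in space and in time by the total variation of u⁰. The distance to equilibrium is then
also bounded in ℓ¹, with a factor 2λ/s (`tsum_equilibrium_defect_le`). After multiplication by Δx it
vanishes, so v = φ(u) in the limit.

Compactness is obtained by sampling: the variation bounds make a step function L¹-close, uniformly
in the mesh, to its values at the points of a rational lattice, and a diagonal extraction makes
these values converge (`exists_subseq_ae_tendsto`). Fatou's lemma transfers the translation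
estimates to the limits, which gives BV.

For the weak form, exact transport is tested against ψ; this yields difference quotients of ψ along
the directions (1, ±λ) (`weak_form_moments`). Since relaxation preserves u = f₊ + f₋, only these
quotients and a term from the first time layer remain, and dominated convergence gives the
conservation law with its initial value. -/

/-! ### The scheme in kinetic variables -/

/-- The kinetic variable `u / 2 + e v / (2 λ)`; `e = 1` moves right and `e = -1` moves left. -/
def kinetic (lam e : ℝ) (m : ℝ × ℝ) : ℝ := m.1 / 2 + e * (m.2 / (2 * lam))

/-- The equilibrium value of the kinetic variable. -/
def kineticEq (φ : ℝ → ℝ) (lam e : ℝ) (u : ℝ) : ℝ := u / 2 + e * (φ u / (2 * lam))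

/-- The kinetic variable after relaxation. -/
def kineticStar (φ : ℝ → ℝ) (lam s e : ℝ) (m : ℝ × ℝ) : ℝ :=
  (1 - s) * kinetic lam e m + s * kineticEq φ lam e m.1

/-- States whose kinetic variables lie between the equilibrium values at `α` and `β`. -/
def invariantRegion (φ : ℝ → ℝ) (lam α β : ℝ) : Set (ℝ × ℝ) :=
  {m | kinetic lam 1 m ∈ Icc (kineticEq φ lam 1 α) (kineticEq φ lam 1 β) ∧
    kinetic lam (-1) m ∈ Icc (kineticEq φ lam (-1) α) (kineticEq φ lam (-1) β)}

theorem kinetic_add (lam : ℝ) (m : ℝ × ℝ) : kinetic lam 1 m + kinetic lam (-1) m = m.1 := by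
  unfold kinetic; ring

theorem kinetic_sub {lam : ℝ} (hlam : 0 < lam) (m : ℝ × ℝ) :
    lam * (kinetic lam 1 m - kinetic lam (-1) m) = m.2 := by
  unfold kinetic; field_simp; ring

theorem kineticEq_add (φ : ℝ → ℝ) (lam u : ℝ) :
    kineticEq φ lam 1 u + kineticEq φ lam (-1) u = u := by
  unfold kineticEq; ring

/-- In this variable the transport phase is a pure shift: the new value is the relaxed value of the
left neighbour. -/
theorem kinetic_schemeStep_right (φ : ℝ → ℝ) {lam : ℝ} (hlam : 0 < lam) (s : ℝ)
    (m : ℤ → ℝ × ℝ) (j : ℤ) :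
    kinetic lam 1 (schemeStep φ lam s m j) = kineticStar φ lam s 1 (m (j - 1)) := by
  simp only [kinetic, kineticStar, kineticEq, schemeStep, relaxedV]
  field_simp
  ring

theorem kinetic_schemeStep_left (φ : ℝ → ℝ) {lam : ℝ} (hlam : 0 < lam) (s : ℝ)
    (m : ℤ → ℝ × ℝ) (j : ℤ) :
    kinetic lam (-1) (schemeStep φ lam s m j) = kineticStar φ lam s (-1) (m (j + 1)) := by
  simp only [kinetic, kineticStar, kineticEq, schemeStep, relaxedV]
  field_simp
  ring

/-- The derivative is 1/2 + e φ'/(2λ), and the second term is at most 1/2 in absolute value. The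
stability estimates use the speed condition only through this monotonicity. -/
theorem monotoneOn_kineticEq {φ : ℝ → ℝ} (hφ : ContDiff ℝ 1 φ) {lam α β : ℝ} (hlam : 0 < lam)
    (hM : ∀ ξ ∈ Icc α β, |deriv φ ξ| ≤ lam) {e : ℝ} (he : |e| ≤ 1) :
    MonotoneOn (kineticEq φ lam e) (Icc α β) := by
  have hd : Differentiable ℝ φ := hφ.differentiable (by norm_num)
  have hD : ∀ x, HasDerivAt (kineticEq φ lam e) (1 / 2 + e * (deriv φ x / (2 * lam))) x := fun x =>
    ((hasDerivAt_id x).div_const 2).add (((hd x).hasDerivAt.div_const (2 * lam)).const_mul e)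
  refine monotoneOn_of_deriv_nonneg (convex_Icc α β)
    (fun x _ => (hD x).continuousAt.continuousWithinAt)
    (fun x _ => (hD x).differentiableAt.differentiableWithinAt) fun x hx => ?_
  rw [(hD x).deriv]
  have h1 : |e * (deriv φ x / (2 * lam))| ≤ 1 / 2 := by
    rw [abs_mul, abs_div, abs_of_pos (by positivity : (0 : ℝ) < 2 * lam)]
    calc |e| * (|deriv φ x| / (2 * lam)) ≤ 1 * (lam / (2 * lam)) := by
          gcongr; exact hM x (interior_subset hx)
      _ = 1 / 2 := by field_simp
  linarith [neg_abs_le (e * (deriv φ x / (2 * lam)))]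

/-! ### Invariant region and ℓ¹ contraction. -/

section Contraction

variable {φ : ℝ → ℝ} {lam α β s : ℝ}

theorem fst_mem_of_mem_invariantRegion {m : ℝ × ℝ} (hm : m ∈ invariantRegion φ lam α β) :
    m.1 ∈ Icc α β := by
  have h0 := kinetic_add lam m
  have h1 := kineticEq_add φ lam α
  have h2 := kineticEq_add φ lam β
  obtain ⟨⟨a, b⟩, c, d⟩ := hm
  constructor <;> linarith

theorem equilibrium_mem_invariantRegion
    (hr : MonotoneOn (kineticEq φ lam 1) (Icc α β))
    (hl : MonotoneOn (kineticEq φ lam (-1)) (Icc α β)) {a : ℝ} (ha : a ∈ Icc α β) :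
    (a, φ a) ∈ invariantRegion φ lam α β := by
  have hα : α ∈ Icc α β := left_mem_Icc.2 (ha.1.trans ha.2)
  have hβ : β ∈ Icc α β := right_mem_Icc.2 (ha.1.trans ha.2)
  exact ⟨⟨hr hα ha ha.1, hr ha hβ ha.2⟩, ⟨hl hα ha ha.1, hl ha hβ ha.2⟩⟩

/-- Relaxation is a convex combination, because 0 < s ≤ 1, of two points of the same interval: the
old value and, by monotonicity, the equilibrium value. -/
theorem kineticStar_mem (hs : s ∈ Ioc (0 : ℝ) 1) {e : ℝ}
    (hmono : MonotoneOn (kineticEq φ lam e) (Icc α β)) {m : ℝ × ℝ} (hm : m.1 ∈ Icc α β)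
    (hk : kinetic lam e m ∈ Icc (kineticEq φ lam e α) (kineticEq φ lam e β)) :
    kineticStar φ lam s e m ∈ Icc (kineticEq φ lam e α) (kineticEq φ lam e β) := by
  have hα : α ∈ Icc α β := left_mem_Icc.2 (hm.1.trans hm.2)
  have hβ : β ∈ Icc α β := right_mem_Icc.2 (hm.1.trans hm.2)
  have he : kineticEq φ lam e m.1 ∈ Icc (kineticEq φ lam e α) (kineticEq φ lam e β) :=
    ⟨hmono hα hm hm.1, hmono hm hβ hm.2⟩
  exact convex_Icc _ _ hk he (by linarith [hs.2]) hs.1.le (by ring)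

theorem schemeStep_mem_invariantRegion (hlam : 0 < lam) (hs : s ∈ Ioc (0 : ℝ) 1)
    (hr : MonotoneOn (kineticEq φ lam 1) (Icc α β))
    (hl : MonotoneOn (kineticEq φ lam (-1)) (Icc α β)) {m : ℤ → ℝ × ℝ}
    (hm : ∀ j, m j ∈ invariantRegion φ lam α β) (j : ℤ) :
    schemeStep φ lam s m j ∈ invariantRegion φ lam α β := by
  refine ⟨?_, ?_⟩
  · rw [kinetic_schemeStep_right φ hlam]
    exact kineticStar_mem hs hr (fst_mem_of_mem_invariantRegion (hm _)) (hm _).1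
  · rw [kinetic_schemeStep_left φ hlam]
    exact kineticStar_mem hs hl (fst_mem_of_mem_invariantRegion (hm _)) (hm _).2

theorem exists_bound_invariantRegion (hlam : 0 < lam) (hs : s ∈ Ioc (0 : ℝ) 1)
    (hr : MonotoneOn (kineticEq φ lam 1) (Icc α β))
    (hl : MonotoneOn (kineticEq φ lam (-1)) (Icc α β)) :
    ∃ C : ℝ, ∀ m ∈ invariantRegion φ lam α β, |m.1| ≤ C ∧ |m.2| ≤ C ∧
      ∀ e ∈ ({1, -1} : Set ℝ), |kinetic lam e m| ≤ C ∧ |kineticStar φ lam s e m| ≤ C := by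
  let B : ℝ → ℝ := fun e => max |kineticEq φ lam e α| |kineticEq φ lam e β|
  have hB : ∀ e, 0 ≤ B e := fun e => (abs_nonneg _).trans (le_max_left _ _)
  -- One constant, independent of the mesh, serves for u = f₊ + f₋, for v = λ (f₊ - f₋), and for the
  -- kinetic variables before and after relaxation.
  refine ⟨B 1 + B (-1) + lam * (B 1 + B (-1)), fun m hm => ?_⟩
  have hk : ∀ e ∈ ({1, -1} : Set ℝ), |kinetic lam e m| ≤ B e ∧ |kineticStar φ lam s e m| ≤ B e := by
    rintro e (rfl | rfl)
    · have h := kineticStar_mem hs hr (fst_mem_of_mem_invariantRegion hm) hm.1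
      exact ⟨abs_le_max_abs_abs hm.1.1 hm.1.2, abs_le_max_abs_abs h.1 h.2⟩
    · have h := kineticStar_mem hs hl (fst_mem_of_mem_invariantRegion hm) hm.2
      exact ⟨abs_le_max_abs_abs hm.2.1 hm.2.2, abs_le_max_abs_abs h.1 h.2⟩
  have hle : 0 ≤ lam * (B 1 + B (-1)) := mul_nonneg hlam.le (add_nonneg (hB _) (hB _))
  have h1 := (hk 1 (by simp)).1
  have h2 := (hk (-1) (by simp)).1
  refine ⟨?_, ?_, fun e he => ?_⟩
  · rw [← kinetic_add lam m]
    linarith [abs_add_le (kinetic lam 1 m) (kinetic lam (-1) m)]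
  · rw [← kinetic_sub hlam m, abs_mul, abs_of_pos hlam]
    have : |kinetic lam 1 m - kinetic lam (-1) m| ≤ B 1 + B (-1) :=
      (abs_sub _ _).trans (add_le_add h1 h2)
    linarith [mul_le_mul_of_nonneg_left this hlam.le, hB 1, hB (-1)]
  · have he' : B e ≤ B 1 + B (-1) + lam * (B 1 + B (-1)) := by
      rcases he with rfl | rfl <;> linarith [hB 1, hB (-1)]
    exact ⟨(hk e he).1.trans he', (hk e he).2.trans he'⟩

/-- The distance of two states in the kinetic variables. -/
def kineticDist (lam : ℝ) (m m' : ℝ × ℝ) : ℝ :=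
  |kinetic lam 1 m - kinetic lam 1 m'| + |kinetic lam (-1) m - kinetic lam (-1) m'|

theorem abs_fst_sub_le (lam : ℝ) (m m' : ℝ × ℝ) : |m.1 - m'.1| ≤ kineticDist lam m m' := by
  rw [← kinetic_add lam m, ← kinetic_add lam m', add_sub_add_comm]
  exact abs_add_le _ _

theorem abs_snd_sub_le (hlam : 0 < lam) (m m' : ℝ × ℝ) :
    |m.2 - m'.2| ≤ lam * kineticDist lam m m' := by
  rw [← kinetic_sub hlam m, ← kinetic_sub hlam m', ← mul_sub, abs_mul, abs_of_pos hlam]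
  refine mul_le_mul_of_nonneg_left ?_ hlam.le
  rw [sub_sub_sub_comm]
  exact abs_sub _ _

theorem tsum_abs_snd_sub_le (hlam : 0 < lam) (m m' : ℤ → ℝ × ℝ) :
    ∑' j, ENNReal.ofReal |(m j).2 - (m' j).2| ≤
      ENNReal.ofReal lam * ∑' j, ENNReal.ofReal (kineticDist lam (m j) (m' j)) := by
  rw [← ENNReal.tsum_mul_left]
  refine ENNReal.tsum_le_tsum fun j => ?_
  rw [← ENNReal.ofReal_mul hlam.le]
  exact ENNReal.ofReal_le_ofReal (abs_snd_sub_le hlam _ _)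

/-- By monotonicity both differences have the sign of u - w, so the absolute values add without
cancellation. -/
theorem kineticEq_dist (hr : MonotoneOn (kineticEq φ lam 1) (Icc α β))
    (hl : MonotoneOn (kineticEq φ lam (-1)) (Icc α β)) {u w : ℝ}
    (hu : u ∈ Icc α β) (hw : w ∈ Icc α β) :
    |kineticEq φ lam 1 u - kineticEq φ lam 1 w| +
      |kineticEq φ lam (-1) u - kineticEq φ lam (-1) w| = |u - w| := by
  have h1 := kineticEq_add φ lam u
  have h2 := kineticEq_add φ lam w
  rcases le_total u w with h | h
  · have a := hr hu hw h
    have b := hl hu hw h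
    rw [abs_of_nonpos (by linarith), abs_of_nonpos (by linarith), abs_of_nonpos (by linarith)]
    linarith
  · have a := hr hw hu h
    have b := hl hw hu h
    rw [abs_of_nonneg (by linarith), abs_of_nonneg (by linarith), abs_of_nonneg (by linarith)]
    linarith

/-- The equilibrium parts together contribute s |u - u'|, which is at most s times the kinetic
distance; the unrelaxed parts contribute the remaining fraction 1 - s. -/
theorem kineticStar_dist_le (hs : s ∈ Ioc (0 : ℝ) 1)
    (hr : MonotoneOn (kineticEq φ lam 1) (Icc α β))
    (hl : MonotoneOn (kineticEq φ lam (-1)) (Icc α β)) {m m' : ℝ × ℝ}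
    (hm : m ∈ invariantRegion φ lam α β) (hm' : m' ∈ invariantRegion φ lam α β) :
    |kineticStar φ lam s 1 m - kineticStar φ lam s 1 m'| +
      |kineticStar φ lam s (-1) m - kineticStar φ lam s (-1) m'| ≤ kineticDist lam m m' := by
  have h1 := kineticEq_dist hr hl (fst_mem_of_mem_invariantRegion hm)
    (fst_mem_of_mem_invariantRegion hm')
  have h2 := abs_fst_sub_le lam m m'
  have key : ∀ e, |kineticStar φ lam s e m - kineticStar φ lam s e m'| ≤
      (1 - s) * |kinetic lam e m - kinetic lam e m'| +
        s * |kineticEq φ lam e m.1 - kineticEq φ lam e m'.1| := fun e => by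
    have : kineticStar φ lam s e m - kineticStar φ lam s e m' =
        (1 - s) * (kinetic lam e m - kinetic lam e m') +
          s * (kineticEq φ lam e m.1 - kineticEq φ lam e m'.1) := by
      unfold kineticStar; ring
    rw [this]
    refine (abs_add_le _ _).trans_eq ?_
    rw [abs_mul, abs_mul, abs_of_nonneg (by linarith [hs.2] : 0 ≤ 1 - s), abs_of_pos hs.1]
  have h3 : s * |m.1 - m'.1| ≤ s * kineticDist lam m m' := mul_le_mul_of_nonneg_left h2 hs.1.le
  have k1 := key 1
  have k2 := key (-1)
  rw [← h1] at h3
  unfold kineticDist at *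
  linarith

theorem kineticDist_nonneg (lam : ℝ) (m m' : ℝ × ℝ) : 0 ≤ kineticDist lam m m' := by
  unfold kineticDist; positivity

/-- One step of the scheme is an `ℓ¹` contraction in the kinetic variables. -/
theorem tsum_kineticDist_schemeStep_le (hlam : 0 < lam) (hs : s ∈ Ioc (0 : ℝ) 1)
    (hr : MonotoneOn (kineticEq φ lam 1) (Icc α β))
    (hl : MonotoneOn (kineticEq φ lam (-1)) (Icc α β)) {m m' : ℤ → ℝ × ℝ}
    (hm : ∀ j, m j ∈ invariantRegion φ lam α β) (hm' : ∀ j, m' j ∈ invariantRegion φ lam α β) :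
    ∑' j, ENNReal.ofReal (kineticDist lam (schemeStep φ lam s m j) (schemeStep φ lam s m' j)) ≤
      ∑' j, ENNReal.ofReal (kineticDist lam (m j) (m' j)) := by
  let A : ℝ → ℤ → ℝ≥0∞ := fun e j =>
    ENNReal.ofReal |kineticStar φ lam s e (m j) - kineticStar φ lam s e (m' j)|
  have h1 : ∀ j, ENNReal.ofReal (kineticDist lam (schemeStep φ lam s m j)
      (schemeStep φ lam s m' j)) = A 1 (j - 1) + A (-1) (j + 1) := fun j => by
    unfold kineticDist
    rw [ENNReal.ofReal_add (abs_nonneg _) (abs_nonneg _)]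
    simp only [kinetic_schemeStep_right φ hlam, kinetic_schemeStep_left φ hlam, A]
  calc _ = ∑' j, A 1 (j - 1) + ∑' j, A (-1) (j + 1) := by
        simp_rw [h1]; exact ENNReal.tsum_add
    -- Transport only permutes the cells, so it preserves each of the two sums.
    _ = ∑' j, A 1 j + ∑' j, A (-1) j := by
        rw [← (Equiv.subRight (1 : ℤ)).tsum_eq (A 1), ← (Equiv.addRight (1 : ℤ)).tsum_eq (A (-1))]
        rfl
    _ = ∑' j, (A 1 j + A (-1) j) := ENNReal.tsum_add.symm
    _ ≤ _ := by
        refine ENNReal.tsum_le_tsum fun j => ?_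
        simp only [A]
        rw [← ENNReal.ofReal_add (abs_nonneg _) (abs_nonneg _)]
        exact ENNReal.ofReal_le_ofReal (kineticStar_dist_le hs hr hl (hm j) (hm' j))

end Contraction

/-! ### Uniform variation bounds and distance to equilibrium. -/

section Moments

variable {φ u₀ : ℝ → ℝ} {lam α β s dx : ℝ}

theorem moments_mem_invariantRegion (hlam : 0 < lam) (hs : s ∈ Ioc (0 : ℝ) 1)
    (hr : MonotoneOn (kineticEq φ lam 1) (Icc α β))
    (hl : MonotoneOn (kineticEq φ lam (-1)) (Icc α β))
    (h0 : ∀ j, (initialMoments φ u₀ dx j).1 ∈ Icc α β) (n : ℕ) :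
    ∀ j, moments φ u₀ lam s dx n j ∈ invariantRegion φ lam α β := by
  induction n with
  | zero => exact fun j => equilibrium_mem_invariantRegion hr hl (h0 j)
  | succ n ih => exact schemeStep_mem_invariantRegion hlam hs hr hl ih

theorem kineticDist_initialMoments (hr : MonotoneOn (kineticEq φ lam 1) (Icc α β))
    (hl : MonotoneOn (kineticEq φ lam (-1)) (Icc α β))
    (h0 : ∀ j, (initialMoments φ u₀ dx j).1 ∈ Icc α β) (i j : ℤ) :
    kineticDist lam (initialMoments φ u₀ dx i) (initialMoments φ u₀ dx j) =
      |(initialMoments φ u₀ dx i).1 - (initialMoments φ u₀ dx j).1| :=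
  kineticEq_dist hr hl (h0 i) (h0 j)

/-- The scheme commutes with translation by one cell, so the contraction applies to the solution and
its translate. -/
theorem tsum_kineticDist_space_le (hlam : 0 < lam) (hs : s ∈ Ioc (0 : ℝ) 1)
    (hr : MonotoneOn (kineticEq φ lam 1) (Icc α β))
    (hl : MonotoneOn (kineticEq φ lam (-1)) (Icc α β))
    (h0 : ∀ j, (initialMoments φ u₀ dx j).1 ∈ Icc α β) {V : ℝ≥0∞}
    (hV : ∑' j, ENNReal.ofReal |(initialMoments φ u₀ dx (j + 1)).1 -
      (initialMoments φ u₀ dx j).1| ≤ V) (n : ℕ) :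
    ∑' j, ENNReal.ofReal (kineticDist lam (moments φ u₀ lam s dx n (j + 1))
      (moments φ u₀ lam s dx n j)) ≤ V := by
  induction n with
  | zero =>
    refine le_trans (le_of_eq (tsum_congr fun j => ?_)) hV
    exact congrArg _ (kineticDist_initialMoments hr hl h0 _ _)
  | succ n ih =>
    refine le_trans ?_ ih
    have hm := moments_mem_invariantRegion (u₀ := u₀) (dx := dx) hlam hs hr hl h0 n
    have := tsum_kineticDist_schemeStep_le hlam hs hr hl (fun j => hm (j + 1)) hm
    refine le_trans (le_of_eq (tsum_congr fun j => ?_)) this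
    simp only [moments, schemeStep, relaxedV]
    ring_nf

/-- The contraction, applied to consecutive time levels, reduces everything to the first step. The
initial data being at equilibrium, that step is a pure shift, and its time increments are space
increments of the initial data. -/
theorem tsum_kineticDist_time_le (hlam : 0 < lam) (hs : s ∈ Ioc (0 : ℝ) 1)
    (hr : MonotoneOn (kineticEq φ lam 1) (Icc α β))
    (hl : MonotoneOn (kineticEq φ lam (-1)) (Icc α β))
    (h0 : ∀ j, (initialMoments φ u₀ dx j).1 ∈ Icc α β) {V : ℝ≥0∞}
    (hV : ∑' j, ENNReal.ofReal |(initialMoments φ u₀ dx (j + 1)).1 -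
      (initialMoments φ u₀ dx j).1| ≤ V) (n : ℕ) :
    ∑' j, ENNReal.ofReal (kineticDist lam (moments φ u₀ lam s dx (n + 1) j)
      (moments φ u₀ lam s dx n j)) ≤ V := by
  induction n with
  | zero =>
    set m := initialMoments φ u₀ dx with hm
    have hstar : ∀ e j, kineticStar φ lam s e (m j) = kinetic lam e (m j) := fun e j => by
      have : (m j).2 = φ (m j).1 := rfl
      unfold kineticStar kineticEq kinetic
      rw [this]; ring
    let A : ℝ → ℤ → ℝ≥0∞ := fun e j =>
      ENNReal.ofReal |kinetic lam e (m (j + 1)) - kinetic lam e (m j)|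
    have h1 : ∀ j, ENNReal.ofReal (kineticDist lam (schemeStep φ lam s m j) (m j)) =
        A 1 (j - 1) + A (-1) j := fun j => by
      unfold kineticDist
      rw [ENNReal.ofReal_add (abs_nonneg _) (abs_nonneg _)]
      simp only [kinetic_schemeStep_right φ hlam, kinetic_schemeStep_left φ hlam, A, hstar,
        sub_add_cancel]
      rw [abs_sub_comm]
    refine le_trans (le_of_eq ?_) hV
    calc _ = ∑' j, A 1 (j - 1) + ∑' j, A (-1) j := by
          rw [← ENNReal.tsum_add]; exact tsum_congr h1
      _ = ∑' j, A 1 j + ∑' j, A (-1) j := by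
          rw [← (Equiv.subRight (1 : ℤ)).tsum_eq (A 1)]; rfl
      _ = ∑' j, (A 1 j + A (-1) j) := ENNReal.tsum_add.symm
      _ = _ := tsum_congr fun j => by
          rw [← kineticDist_initialMoments hr hl h0 (j + 1) j]
          exact (ENNReal.ofReal_add (abs_nonneg _) (abs_nonneg _)).symm
  | succ n ih =>
    have hm := moments_mem_invariantRegion (u₀ := u₀) (dx := dx) hlam hs hr hl h0
    exact (tsum_kineticDist_schemeStep_le hlam hs hr hl (hm (n + 1)) (hm n)).trans ih

/-- The distance to equilibrium is controlled by the variation in space and time. -/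
theorem tsum_equilibrium_defect_le (hlam : 0 < lam) (hs : s ∈ Ioc (0 : ℝ) 1)
    (hr : MonotoneOn (kineticEq φ lam 1) (Icc α β))
    (hl : MonotoneOn (kineticEq φ lam (-1)) (Icc α β))
    (h0 : ∀ j, (initialMoments φ u₀ dx j).1 ∈ Icc α β) {V : ℝ≥0∞}
    (hV : ∑' j, ENNReal.ofReal |(initialMoments φ u₀ dx (j + 1)).1 -
      (initialMoments φ u₀ dx j).1| ≤ V) (n : ℕ) :
    ∑' j, ENNReal.ofReal |(moments φ u₀ lam s dx n j).2 - φ (moments φ u₀ lam s dx n j).1| ≤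
      ENNReal.ofReal (2 * lam / s) * (V + V) := by
  set m := moments φ u₀ lam s dx with hm
  have h1 : ∀ j, |(m n j).2 - φ (m n j).1| ≤ 2 * lam / s *
      (kineticDist lam (m (n + 1) (j + 1)) (m n (j + 1)) +
        kineticDist lam (m n (j + 1)) (m n j)) := fun j => by
    -- The defect is, up to the factor 2λ/s, the change of f₊ under relaxation. The relaxed value
    -- reappears as f₊ in cell j + 1 at the next time; passing through f₊ in cell j + 1 at time n
    -- splits the change into a time and a space increment.
    have e1 : kineticStar φ lam s 1 (m n j) - kinetic lam 1 (m n j) =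
        s / (2 * lam) * (φ (m n j).1 - (m n j).2) := by
      unfold kineticStar kineticEq kinetic; field_simp; ring
    have e2 : kinetic lam 1 (m (n + 1) (j + 1)) = kineticStar φ lam s 1 (m n j) := by
      have := kinetic_schemeStep_right φ hlam s (m n) (j + 1)
      rwa [add_sub_cancel_right] at this
    have e3 : |(m n j).2 - φ (m n j).1| =
        2 * lam / s * |kineticStar φ lam s 1 (m n j) - kinetic lam 1 (m n j)| := by
      rw [e1, abs_mul, abs_of_pos (div_pos hs.1 (by positivity : 0 < 2 * lam)), abs_sub_comm]
      have := hs.1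
      field_simp
    rw [e3, ← e2]
    have := hs.1
    refine mul_le_mul_of_nonneg_left ?_ (by positivity)
    refine (abs_sub_le _ (kinetic lam 1 (m n (j + 1))) _).trans (add_le_add ?_ ?_) <;>
      exact le_add_of_nonneg_right (abs_nonneg _)
  calc _ ≤ ∑' j, ENNReal.ofReal (2 * lam / s) *
        (ENNReal.ofReal (kineticDist lam (m (n + 1) (j + 1)) (m n (j + 1))) +
          ENNReal.ofReal (kineticDist lam (m n (j + 1)) (m n j))) := by
        refine ENNReal.tsum_le_tsum fun j => ?_
        have := hs.1
        rw [← ENNReal.ofReal_add (kineticDist_nonneg _ _ _) (kineticDist_nonneg _ _ _),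
          ← ENNReal.ofReal_mul (by positivity)]
        exact ENNReal.ofReal_le_ofReal (h1 j)
    _ ≤ _ := by
        rw [ENNReal.tsum_mul_left, ENNReal.tsum_add]
        refine mul_le_mul_right (add_le_add ?_ (tsum_kineticDist_space_le hlam hs hr hl h0 hV n)) _
        refine le_trans (le_of_eq ?_) (tsum_kineticDist_time_le hlam hs hr hl h0 hV n)
        exact (Equiv.addRight (1 : ℤ)).tsum_eq
          fun j => ENNReal.ofReal (kineticDist lam (m (n + 1) j) (m n j))

end Moments

/-! ### Initial data of bounded variation -/

section InitialData

variable {g : ℝ → ℝ} {h C : ℝ}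

theorem locallyIntegrable_of_memLp_top {g : ℝ → ℝ} (hg : MemLp g ⊤ volume) :
    LocallyIntegrable g volume :=
  hg.locallyIntegrable le_top

theorem exists_ae_bound_of_memLp_top {α : Type*} [MeasurableSpace α] {μ : Measure α} {g : α → ℝ}
    (hg : MemLp g ⊤ μ) : ∃ C : ℝ, 0 ≤ C ∧ ∀ᵐ x ∂μ, |g x| ≤ C := by
  refine ⟨(eLpNorm g ⊤ μ).toReal, ENNReal.toReal_nonneg, ?_⟩
  filter_upwards [ae_le_eLpNormEssSup (f := g) (μ := μ)] with x hx
  rw [← Real.norm_eq_abs, ← toReal_enorm]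
  exact ENNReal.toReal_mono hg.2.ne (by rwa [eLpNorm_exponent_top])

theorem integral_mul_deriv_le_totalVariation1 (hV : totalVariation1 univ g < ⊤) {ψ : ℝ → ℝ}
    (h1 : ContDiff ℝ 1 ψ) (h2 : HasCompactSupport ψ) (h3 : ∀ x, |ψ x| ≤ 1) :
    ∫ x, g x * deriv ψ x ≤ (totalVariation1 univ g).toReal := by
  rw [← ENNReal.ofReal_le_iff_le_toReal hV.ne, ← setIntegral_univ]
  exact le_iSup₂_of_le (f := fun ψ _ => ENNReal.ofReal (∫ x in univ, g x * deriv ψ x)) ψ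
    ⟨h1, h2, subset_univ _, h3⟩ le_rfl

/-- Moving the translation onto η leaves h times the integral of g ψ', where -ψ is the mean of η
over [y - h, y]. As a mean, ψ inherits the bound 1 and compact support, and it is C¹. -/
theorem integral_translate_sub_mul_continuous_le (hg : MemLp g ⊤ volume)
    (hV : totalVariation1 univ g < ⊤) (hh : 0 < h) {η : ℝ → ℝ} (hη : Continuous η)
    (hc : HasCompactSupport η) (hb : ∀ x, |η x| ≤ 1) :
    ∫ x, (g (x + h) - g x) * η x ≤ h * (totalVariation1 univ g).toReal := by
  have hloc := locallyIntegrable_of_memLp_top hg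
  let G : ℝ → ℝ := fun y => ∫ t in (0 : ℝ)..y, η t
  have hG : ∀ y, HasDerivAt G (η y) y := fun y => hη.integral_hasStrictDerivAt 0 y |>.hasDerivAt
  let ψ : ℝ → ℝ := fun y => h⁻¹ * (G (y - h) - G y)
  have hψ' : ∀ y, HasDerivAt ψ (h⁻¹ * (η (y - h) - η y)) y := fun y =>
    (((hG (y - h)).comp_sub_const y h).sub (hG y)).const_mul _
  have hψd : deriv ψ = fun y => h⁻¹ * (η (y - h) - η y) := funext fun y => (hψ' y).deriv
  have hψint : ∀ y, ψ y = h⁻¹ * ∫ t in y..(y - h), η t := fun y => by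
    simp only [ψ, G]
    rw [intervalIntegral.integral_interval_sub_left] <;> exact hη.intervalIntegrable _ _
  have hψ1 : ContDiff ℝ 1 ψ := by
    rw [contDiff_one_iff_deriv, hψd]
    exact ⟨fun y => (hψ' y).differentiableAt, by fun_prop⟩
  have hψb : ∀ y, |ψ y| ≤ 1 := fun y => by
    rw [hψint, abs_mul, abs_of_pos (inv_pos.2 hh)]
    have := intervalIntegral.norm_integral_le_of_norm_le_const (a := y) (b := y - h) (C := 1)
      (f := η) fun x _ => hb x
    rw [Real.norm_eq_abs, sub_sub_cancel_left, abs_neg, abs_of_pos hh, one_mul] at this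
    calc h⁻¹ * _ ≤ h⁻¹ * h := by gcongr
      _ = 1 := inv_mul_cancel₀ hh.ne'
  obtain ⟨R, hR⟩ := hc.isCompact.isBounded.subset_closedBall 0
  have hη0 : ∀ x, R < |x| → η x = 0 := fun x hx => by
    refine image_eq_zero_of_notMem_tsupport fun hm => ?_
    have := hR hm
    rw [mem_closedBall_zero_iff, Real.norm_eq_abs] at this
    linarith
  have hψc : HasCompactSupport ψ := by
    refine HasCompactSupport.intro (isCompact_Icc (a := -R) (b := R + h)) fun y hy => ?_
    rw [hψint, intervalIntegral.integral_congr (g := fun _ => 0), intervalIntegral.integral_zero,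
      mul_zero]
    intro t ht
    rw [uIcc_of_ge (by linarith)] at ht
    refine hη0 t ?_
    rw [mem_Icc, not_and_or, not_le, not_le] at hy
    rcases hy with hy | hy
    · exact lt_of_lt_of_le (by linarith [ht.2]) (neg_le_abs t)
    · exact lt_of_lt_of_le (by linarith [ht.1]) (le_abs_self t)
  have key := integral_mul_deriv_le_totalVariation1 hV hψ1 hψc hψb
  have i1 : Integrable fun x => g x * η x := by
    simpa [smul_eq_mul, mul_comm] using hloc.integrable_smul_left_of_hasCompactSupport hη hc
  have i2 : Integrable fun x => g x * η (x - h) := by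
    have := hloc.integrable_smul_left_of_hasCompactSupport (g := fun x => η (x - h))
      (by fun_prop) (hc.comp_homeomorph (Homeomorph.subRight h))
    simpa [smul_eq_mul, mul_comm] using this
  have i3 : Integrable fun x => g (x + h) * η x := by
    simpa using i2.comp_add_right h
  have e1 : ∫ x, g (x + h) * η x = ∫ x, g x * η (x - h) := by
    simpa using integral_add_right_eq_self (μ := volume) (fun x => g x * η (x - h)) h
  have e2 : ∫ x, (g (x + h) - g x) * η x = h * ∫ x, g x * deriv ψ x := by
    simp_rw [sub_mul]
    rw [integral_sub i3 i1, e1, ← integral_sub i2 i1, ← integral_const_mul]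
    refine integral_congr_ae (ae_of_all _ fun x => ?_)
    simp only [hψd]
    field_simp
  rw [e2]
  exact mul_le_mul_of_nonneg_left key hh.le

theorem integral_translate_sub_mul_le (hg : MemLp g ⊤ volume)
    (hV : totalVariation1 univ g < ⊤) (hh : 0 < h) {σ : ℝ → ℝ} (hσ : Integrable σ)
    (hb : ∀ x, |σ x| ≤ 1) :
    ∫ x, (g (x + h) - g x) * σ x ≤ h * (totalVariation1 univ g).toReal := by
  obtain ⟨C, hC0, hC⟩ := exists_ae_bound_of_memLp_top hg
  have hq : Measure.QuasiMeasurePreserving (fun x : ℝ => x + h) volume volume :=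
    (measurePreserving_add_right volume h).quasiMeasurePreserving
  have hCh : ∀ᵐ x, |g (x + h)| ≤ C := hq.ae hC
  have hD : AEStronglyMeasurable (fun x => g (x + h) - g x) volume :=
    (hg.1.comp_quasiMeasurePreserving hq).sub hg.1
  have hDb : ∀ᵐ x, ‖g (x + h) - g x‖ ≤ 2 * C := by
    filter_upwards [hC, hCh] with x h1 h2
    rw [Real.norm_eq_abs]
    linarith [abs_sub (g (x + h)) (g x)]
  refine le_of_forall_pos_le_add fun ε hε => ?_
  -- The error is weighted by the bound 2C on the translate difference; the extra 1 keeps the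
  -- denominator positive when C = 0.
  obtain ⟨η, h1, h2, h3, h4⟩ := hσ.exists_hasCompactSupport_integral_sub_le
    (ε := ε / (2 * C + 1)) (by positivity)
  -- Clipping to [-1, 1] is 1-Lipschitz and fixes the values of σ, so it makes η admissible without
  -- increasing its distance to σ.
  let T : ℝ → ℝ := fun y => max (-1) (min 1 y)
  let θ : ℝ → ℝ := fun x => T (η x)
  have hθc : Continuous θ := by fun_prop
  have hθs : HasCompactSupport θ := h1.comp_left (g := T) (by simp [T])
  have hθb : ∀ x, |θ x| ≤ 1 := fun x =>
    abs_le.2 ⟨le_max_left _ _, max_le (by norm_num) (min_le_left _ _)⟩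
  have hθd : ∀ x, ‖σ x - θ x‖ ≤ ‖σ x - η x‖ := fun x => by
    have e : σ x = T (σ x) := by
      have := abs_le.1 (hb x)
      simp only [T]
      rw [min_eq_right this.2, max_eq_right this.1]
    conv_lhs => rw [e]
    refine (abs_max_sub_max_le_max _ _ _ _).trans ?_
    rw [sub_self, abs_zero]
    refine max_le (norm_nonneg _) ?_
    refine (abs_min_sub_min_le_max _ _ _ _).trans ?_
    rw [sub_self, abs_zero]
    exact max_le (norm_nonneg _) le_rfl
  have hθi : Integrable θ := hθc.integrable_of_hasCompactSupport hθs
  have i1 := hσ.bdd_mul hD hDb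
  have i2 := hθi.bdd_mul hD hDb
  have key := integral_translate_sub_mul_continuous_le hg hV hh hθc hθs hθb
  have : (∫ x, (g (x + h) - g x) * σ x) - ∫ x, (g (x + h) - g x) * θ x ≤ ε := by
    rw [← integral_sub i1 i2]
    calc _ ≤ ∫ x, (2 * C) * ‖σ x - η x‖ := by
          refine integral_mono_ae (i1.sub i2) ((hσ.sub h4).norm.const_mul _) ?_
          filter_upwards [hDb] with x hx
          rw [← mul_sub]
          refine (le_abs_self _).trans ?_
          rw [abs_mul]
          exact mul_le_mul hx (hθd x) (abs_nonneg _) (by positivity)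
      _ ≤ 2 * C * (ε / (2 * C + 1)) := by rw [integral_const_mul]; gcongr
      _ ≤ ε := by
          rw [mul_div_assoc', div_le_iff₀ (by positivity)]
          nlinarith
  linarith

/-- Translation estimate in `L¹` for bounded functions of finite total variation. -/
theorem lintegral_translate_sub_le (hg : MemLp g ⊤ volume)
    (hV : totalVariation1 univ g < ⊤) (hh : 0 < h) :
    ∫⁻ x, ‖g (x + h) - g x‖ₑ ≤ ENNReal.ofReal (h * (totalVariation1 univ g).toReal) := by
  have hq : Measure.QuasiMeasurePreserving (fun x : ℝ => x + h) volume volume :=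
    (measurePreserving_add_right volume h).quasiMeasurePreserving
  have hD : AEStronglyMeasurable (fun x => g (x + h) - g x) volume :=
    (hg.1.comp_quasiMeasurePreserving hq).sub hg.1
  have hcov : AECover volume atTop fun n : ℕ => Icc (-(n : ℝ)) n :=
    aecover_Icc (tendsto_neg_atTop_atBot.comp tendsto_natCast_atTop_atTop)
      tendsto_natCast_atTop_atTop
  refine le_of_tendsto' (hcov.lintegral_tendsto_of_nat hD.enorm) fun n => ?_
  let S : Set ℝ := Icc (-(n : ℝ)) n
  -- Testing with the sign produces the absolute value. The cut-off makes σ integrable and is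
  -- removed by exhausting the line.
  let σ : ℝ → ℝ := S.indicator fun x => SignType.sign (g (x + h) - g x)
  have hσb : ∀ x, |σ x| ≤ 1 := fun x => by
    simp only [σ, indicator]
    split_ifs
    · rcases lt_trichotomy (g (x + h) - g x) 0 with h | h | h
      · simp [sign_neg h]
      · simp [h]
      · simp [sign_pos h]
    · simp
  have hsm : Measurable fun y : ℝ => ((SignType.sign y : SignType) : ℝ) := by
    have : (fun y : ℝ => ((SignType.sign y : SignType) : ℝ)) =
        fun y => if 0 < y then 1 else if y < 0 then -1 else 0 := by
      ext y
      rw [sign_apply]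
      split_ifs <;> simp
    rw [this]
    exact Measurable.ite measurableSet_Ioi measurable_const
      (Measurable.ite measurableSet_Iio measurable_const measurable_const)
  have hσi : Integrable σ := by
    rw [integrable_indicator_iff measurableSet_Icc]
    refine Measure.integrableOn_of_bounded (M := 1) (by simp)
      (hsm.comp_aemeasurable hD.aemeasurable).aestronglyMeasurable ?_
    filter_upwards [ae_restrict_mem measurableSet_Icc] with x hx
    have := hσb x
    simp only [σ] at this
    rwa [indicator_of_mem hx] at this
  have key := integral_translate_sub_mul_le hg hV hh hσi hσb
  obtain ⟨C, hC0, hC⟩ := exists_ae_bound_of_memLp_top hg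
  have hDi : IntegrableOn (fun x => ‖g (x + h) - g x‖) S := by
    refine Measure.integrableOn_of_bounded (M := 2 * C) (by simp [S]) hD.norm ?_
    refine ae_restrict_of_ae ?_
    filter_upwards [hC, hq.ae hC] with x h1 h2
    rw [norm_norm, Real.norm_eq_abs]
    linarith [abs_sub (g (x + h)) (g x)]
  have e : ∫ x, (g (x + h) - g x) * σ x = ∫ x in S, ‖g (x + h) - g x‖ := by
    rw [← integral_indicator measurableSet_Icc]
    refine integral_congr_ae (ae_of_all _ fun x => ?_)
    simp only [σ, indicator]
    split_ifs
    · rw [Real.norm_eq_abs, mul_comm, sign_mul_self]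
    · simp
  rw [e] at key
  calc ∫⁻ x in S, ‖g (x + h) - g x‖ₑ = ∫⁻ x in S, ENNReal.ofReal ‖g (x + h) - g x‖ := by
        simp_rw [ofReal_norm]
    _ = ENNReal.ofReal (∫ x in S, ‖g (x + h) - g x‖) :=
        (ofReal_integral_eq_lintegral_ofReal hDi (ae_of_all _ fun x => norm_nonneg _)).symm
    _ ≤ _ := ENNReal.ofReal_le_ofReal key

/-- A difference of neighbouring averages is the average over one cell of g(x + Δx) - g(x). The
cells tile the line, and the factor Δx of the translation estimate cancels the 1/Δx of the averages.
-/
theorem tsum_initialMoments_sub_le (φ : ℝ → ℝ) (hg : MemLp g ⊤ volume)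
    (hV : totalVariation1 univ g < ⊤) {dx : ℝ} (hdx : 0 < dx) :
    ∑' j, ENNReal.ofReal |(initialMoments φ g dx (j + 1)).1 - (initialMoments φ g dx j).1| ≤
      totalVariation1 univ g := by
  have hloc := locallyIntegrable_of_memLp_top hg
  have hint : ∀ a b, IntervalIntegrable g volume a b := fun a b =>
    (hloc.integrableOn_isCompact isCompact_uIcc).intervalIntegrable
  have hint' : ∀ a b, IntervalIntegrable (fun x => g (x + dx)) volume a b := fun a b => by
    simpa using (hint (a + dx) (b + dx)).comp_add_right dx
  have e : ∀ j : ℤ, (initialMoments φ g dx (j + 1)).1 - (initialMoments φ g dx j).1 =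
      dx⁻¹ * ∫ x in Ioc (j * dx) ((j + 1) * dx), (g (x + dx) - g x) := fun j => by
    have hj : (j : ℝ) * dx ≤ (j + 1) * dx := by nlinarith
    rw [← intervalIntegral.integral_of_le hj, intervalIntegral.integral_sub (hint' _ _) (hint _ _),
      intervalIntegral.integral_comp_add_right (fun x => g x) dx]
    simp only [initialMoments, one_div]
    push_cast
    rw [mul_sub]
    ring_nf
  have hdisj := pairwise_disjoint_Ioc_zsmul dx
  have hun := iUnion_Ioc_zsmul hdx
  simp only [zsmul_eq_mul, Int.cast_add, Int.cast_one] at hun hdisj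
  calc _ ≤ ∑' j : ℤ, ENNReal.ofReal dx⁻¹ *
        ∫⁻ x in Ioc (j * dx) ((j + 1) * dx), ‖g (x + dx) - g x‖ₑ := by
        refine ENNReal.tsum_le_tsum fun j => ?_
        rw [e, abs_mul, abs_of_pos (inv_pos.2 hdx), ENNReal.ofReal_mul (inv_pos.2 hdx).le]
        refine mul_le_mul_right ?_ _
        rw [← Real.norm_eq_abs, ofReal_norm]
        exact enorm_integral_le_lintegral_enorm _
    _ = ENNReal.ofReal dx⁻¹ * ∫⁻ x, ‖g (x + dx) - g x‖ₑ := by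
        rw [ENNReal.tsum_mul_left, ← lintegral_iUnion (fun _ => measurableSet_Ioc) hdisj, hun,
          setLIntegral_univ]
    _ ≤ ENNReal.ofReal dx⁻¹ * ENNReal.ofReal (dx * (totalVariation1 univ g).toReal) :=
        mul_le_mul_right (lintegral_translate_sub_le hg hV hdx) _
    _ = totalVariation1 univ g := by
        rw [← ENNReal.ofReal_mul (inv_pos.2 hdx).le, inv_mul_cancel_left₀ hdx.ne',
          ENNReal.ofReal_toReal hV.ne]

theorem essInf_le_ae_le_essSup (hg : MemLp g ⊤ volume) :
    ∀ᵐ x, g x ∈ Icc (essInf g volume) (essSup g volume) := by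
  obtain ⟨C, -, hC⟩ := exists_ae_bound_of_memLp_top hg
  have h1 : IsBoundedUnder (· ≤ ·) (ae volume) g :=
    ⟨C, eventually_map.2 (hC.mono fun x hx => (abs_le.1 hx).2)⟩
  have h2 : IsBoundedUnder (· ≥ ·) (ae volume) g :=
    ⟨-C, eventually_map.2 (hC.mono fun x hx => (abs_le.1 hx).1)⟩
  filter_upwards [ae_le_essSup h1, ae_essInf_le h2] with x a b using ⟨b, a⟩

theorem initialMoments_mem_Icc (φ : ℝ → ℝ) (hg : MemLp g ⊤ volume) {α β : ℝ}
    (h : ∀ᵐ x, g x ∈ Icc α β) {dx : ℝ} (hdx : 0 < dx) (j : ℤ) :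
    (initialMoments φ g dx j).1 ∈ Icc α β := by
  have hloc := locallyIntegrable_of_memLp_top hg
  have hint : ∀ a b, IntervalIntegrable g volume a b := fun a b =>
    (hloc.integrableOn_isCompact isCompact_uIcc).intervalIntegrable
  have hj : (j : ℝ) * dx ≤ (j + 1) * dx := by nlinarith
  have h1 := intervalIntegral.integral_mono_ae (μ := volume) hj (intervalIntegrable_const (c := α))
    (hint _ _) (h.mono fun x hx => hx.1)
  have h2 := intervalIntegral.integral_mono_ae (μ := volume) hj (hint _ _)
    (intervalIntegrable_const (c := β)) (h.mono fun x hx => hx.2)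
  have e : ((j : ℝ) + 1) * dx - j * dx = dx := by ring
  rw [intervalIntegral.integral_const, smul_eq_mul, e] at h1 h2
  simp only [initialMoments, one_div]
  constructor
  · rw [le_inv_mul_iff₀ hdx]; exact h1
  · rw [inv_mul_le_iff₀ hdx]; exact h2

/-- Cell averages converge almost everywhere (Lebesgue differentiation). -/
theorem ae_tendsto_initialMoments (φ : ℝ → ℝ) (hg : MemLp g ⊤ volume) {dx : ℕ → ℝ}
    (hdx : ∀ k, 0 < dx k) (hdx0 : Tendsto dx atTop (𝓝 0)) :
    ∀ᵐ x, Tendsto (fun k => (initialMoments φ g (dx k) ⌊x / dx k⌋).1) atTop (𝓝 (g x)) := by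
  filter_upwards [IsUnifLocDoublingMeasure.ae_tendsto_average (μ := volume)
    (locallyIntegrable_of_memLp_top hg) 1] with x hx
  -- The cell containing x is viewed as a ball about its midpoint. It is not centred at x, hence the
  -- differentiation theorem for balls that merely contain the point.
  have := hx (l := atTop) (fun k => (⌊x / dx k⌋ + 1 / 2) * dx k) (fun k => dx k / 2)
    (tendsto_nhdsWithin_iff.2 ⟨by simpa using hdx0.div_const 2,
      Eventually.of_forall fun k => half_pos (hdx k)⟩)
    (Eventually.of_forall fun k => by
      have h1 := (le_div_iff₀ (hdx k)).1 (Int.floor_le (x / dx k))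
      have h2 := (div_lt_iff₀ (hdx k)).1 (Int.lt_floor_add_one (x / dx k))
      rw [Real.closedBall_eq_Icc]
      constructor <;> linarith)
  refine this.congr fun k => ?_
  have e1 : (⌊x / dx k⌋ + 1 / 2) * dx k - dx k / 2 = ⌊x / dx k⌋ * dx k := by ring
  have e2 : (⌊x / dx k⌋ + 1 / 2) * dx k + dx k / 2 = (⌊x / dx k⌋ + 1) * dx k := by ring
  have hj : (⌊x / dx k⌋ : ℝ) * dx k ≤ (⌊x / dx k⌋ + 1) * dx k := by nlinarith [hdx k]
  rw [Real.closedBall_eq_Icc, e1, e2, setAverage_eq, integral_Icc_eq_integral_Ioc,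
    ← intervalIntegral.integral_of_le hj, Real.volume_real_Icc_of_le hj]
  simp only [initialMoments, one_div, smul_eq_mul]
  congr 2
  ring

end InitialData

/-! ### Step functions -/

section StepFunctions

theorem lintegral_floor_le {dx : ℝ} (hdx : 0 < dx) (F : ℤ → ℝ≥0∞) :
    ∫⁻ x : ℝ, F ⌊x / dx⌋ ≤ ENNReal.ofReal dx * ∑' j, F j := by
  have h1 : ∀ x : ℝ, F ⌊x / dx⌋ ≤
      ∑' j : ℤ, (Ico (j * dx) ((j + 1) * dx)).indicator (fun _ => F j) x := fun x => by
    refine le_trans ?_ (ENNReal.le_tsum ⌊x / dx⌋)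
    rw [indicator_of_mem]
    exact ⟨(le_div_iff₀ hdx).1 (Int.floor_le _), (div_lt_iff₀ hdx).1 (Int.lt_floor_add_one _)⟩
  refine (lintegral_mono h1).trans (le_of_eq ?_)
  rw [lintegral_tsum fun j => (measurable_const.indicator measurableSet_Ico).aemeasurable,
    ← ENNReal.tsum_mul_left]
  refine tsum_congr fun j => ?_
  rw [lintegral_indicator measurableSet_Ico, lintegral_const, Measure.restrict_apply_univ,
    Real.volume_Ico, mul_comm]
  ring_nf

/-- Telescoping over the jumps between y and x: each sits at a point (j + 1)Δx of (y, x], so x lies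
within h to its right. The bound no longer involves y, which may therefore depend on x, and each
indicator has integral h. -/
theorem enorm_sub_le_tsum_indicator_int {dx h : ℝ} (hdx : 0 < dx) (w : ℤ → ℝ) {x y : ℝ}
    (hyx : y ≤ x) (hxy : x - h ≤ y) :
    ‖w ⌊x / dx⌋ - w ⌊y / dx⌋‖ₑ ≤ ∑' j : ℤ, (Ico ((j + 1) * dx) ((j + 1) * dx + h)).indicator
      (fun _ => ENNReal.ofReal |w (j + 1) - w j|) x := by
  set a := ⌊y / dx⌋ with ha
  set b := ⌊x / dx⌋ with hb
  have hab : a ≤ b := Int.floor_mono (by gcongr)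
  have tel : ∀ n : ℕ, ‖w (a + n) - w a‖ₑ ≤
      ∑ i ∈ Finset.range n, ‖w (a + i + 1) - w (a + i)‖ₑ := fun n => by
    induction n with
    | zero => simp
    | succ n ih =>
      rw [Finset.sum_range_succ]
      refine le_trans ?_ (add_le_add_left ih _)
      have : w (a + (n + 1 : ℕ)) - w a =
          (w (a + n) - w a) + (w (a + n + 1) - w (a + n)) := by
        push_cast; rw [← add_assoc]; ring
      rw [this]
      exact enorm_add_le _ _
  obtain ⟨n, hn⟩ := Int.le.dest hab
  rw [← hn]
  refine (tel n).trans ?_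
  have hinj : Function.Injective fun i : ℕ => a + (i : ℤ) := fun i j hij => by simpa using hij
  have hmap := Finset.sum_map (Finset.range n) ⟨_, hinj⟩ fun j => ‖w (j + 1) - w j‖ₑ
  simp only [Function.Embedding.coeFn_mk] at hmap
  rw [← hmap]
  refine le_trans (Finset.sum_le_sum fun j hj => ?_) (ENNReal.sum_le_tsum _)
  rw [Finset.mem_map] at hj
  obtain ⟨i, hi, rfl⟩ := hj
  rw [Finset.mem_range] at hi
  have h1 : a + (i : ℤ) + 1 ≤ b := by omega
  have h2 : ((a + i : ℤ) : ℝ) + 1 ≤ x / dx := by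
    refine le_trans ?_ (Int.floor_le _)
    exact_mod_cast h1
  have h3 : y / dx < ((a + i : ℤ) : ℝ) + 1 := by
    refine (Int.lt_floor_add_one _).trans_le ?_
    push_cast
    have : (0 : ℝ) ≤ i := by positivity
    linarith
  rw [le_div_iff₀ hdx] at h2
  rw [div_lt_iff₀ hdx] at h3
  simp only [Function.Embedding.coeFn_mk]
  have hmem : x ∈ Ico ((((a + i : ℤ) : ℝ) + 1) * dx) ((((a + i : ℤ) : ℝ) + 1) * dx + h) :=
    ⟨h2, by linarith⟩
  rw [indicator_of_mem hmem, ← Real.norm_eq_abs, ofReal_norm]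

theorem enorm_sub_le_tsum_indicator_nat {dt h : ℝ} (hdt : 0 < dt) (w : ℕ → ℝ) {t r : ℝ}
    (hr : 0 ≤ r) (hrt : r ≤ t) (htr : t - h ≤ r) :
    ‖w ⌊t / dt⌋₊ - w ⌊r / dt⌋₊‖ₑ ≤ ∑' i : ℕ, (Ico ((i + 1) * dt) ((i + 1) * dt + h)).indicator
      (fun _ => ENNReal.ofReal |w (i + 1) - w i|) t := by
  have key := enorm_sub_le_tsum_indicator_int hdt (fun j => w j.toNat) hrt htr
  have ht : 0 ≤ t := hr.trans hrt
  rw [Int.floor_toNat, Int.floor_toNat] at key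
  refine key.trans (le_of_eq ?_)
  -- The extension j ↦ `w j.toNat` is constant for j ≤ 0, so negative indices carry no jump.
  rw [← (Nat.cast_injective (R := ℤ)).tsum_eq]
  · refine tsum_congr fun i => ?_
    have e : ((i : ℤ) + 1).toNat = i + 1 := by omega
    simp [e]
  · intro j hj
    by_contra hneg
    have : j < 0 := by
      by_contra h0
      exact hneg ⟨j.toNat, by simp; omega⟩
    apply hj
    have e1 : (j + 1).toNat = 0 := by omega
    have e2 : j.toNat = 0 := by omega
    simp [e1, e2]

variable {dt dx h T : ℝ} {w : ℕ → ℤ → ℝ} {V : ℝ≥0∞}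

theorem measurable_reconstruct (dt dx : ℝ) (w : ℕ → ℤ → ℝ) :
    Measurable (reconstruct dt dx w) := by
  have h1 : Measurable fun q : ℕ × ℤ => w q.1 q.2 := Measurable.of_discrete
  have h2 : Measurable fun p : ℝ × ℝ => (⌊p.1 / dt⌋₊, ⌊p.2 / dx⌋) :=
    (Nat.measurable_floor.comp (measurable_fst.div_const dt)).prodMk
      (Int.measurable_floor.comp (measurable_snd.div_const dx))
  exact Measurable.ite (measurableSet_le measurable_const measurable_fst) (h1.comp h2)
    measurable_const

theorem abs_reconstruct_le {C : ℝ} (hC : ∀ n j, |w n j| ≤ C) (p : ℝ × ℝ) :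
    |reconstruct dt dx w p| ≤ C := by
  unfold reconstruct
  split_ifs
  · exact hC _ _
  · rw [abs_zero]
    exact (abs_nonneg _).trans (hC 0 0)

theorem reconstruct_of_neg {p : ℝ × ℝ} (hp : p.1 < 0) : reconstruct dt dx w p = 0 := by
  simp [reconstruct, hp.not_ge]

theorem lintegral_reconstruct_space_le (hdx : 0 < dx)
    (hw : ∀ n, ∑' j, ENNReal.ofReal |w n (j + 1) - w n j| ≤ V) (t : ℝ) {y : ℝ → ℝ}
    (hy : ∀ x, y x ≤ x) (hy' : ∀ x, x - h ≤ y x) :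
    ∫⁻ x, ‖reconstruct dt dx w (t, x) - reconstruct dt dx w (t, y x)‖ₑ ≤
      ENNReal.ofReal h * V := by
  rcases lt_or_ge t 0 with ht | ht
  · simp [reconstruct, ht.not_ge]
  have h1 : ∀ x, ‖reconstruct dt dx w (t, x) - reconstruct dt dx w (t, y x)‖ₑ ≤
      ∑' j : ℤ, (Ico ((j + 1) * dx) ((j + 1) * dx + h)).indicator
      (fun _ => ENNReal.ofReal |w ⌊t / dt⌋₊ (j + 1) - w ⌊t / dt⌋₊ j|) x := fun x => by
    simp only [reconstruct, ht, if_true]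
    exact enorm_sub_le_tsum_indicator_int hdx (w ⌊t / dt⌋₊) (hy x) (hy' x)
  refine (lintegral_mono h1).trans ?_
  rw [lintegral_tsum fun j => (measurable_const.indicator measurableSet_Ico).aemeasurable]
  refine le_trans (le_of_eq ?_) (mul_le_mul_right (hw ⌊t / dt⌋₊) _)
  rw [← ENNReal.tsum_mul_left]
  refine tsum_congr fun j => ?_
  rw [lintegral_indicator measurableSet_Ico, lintegral_const, Measure.restrict_apply_univ,
    Real.volume_Ico, mul_comm, add_sub_cancel_left]

theorem lintegral_reconstruct_time_slice_le (hdt : 0 < dt) (hdx : 0 < dx)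
    (hw : ∀ n, ∑' j, ENNReal.ofReal |w (n + 1) j - w n j| ≤ V) {t r : ℝ}
    (hr : 0 ≤ r) (hrt : r ≤ t) (htr : t - h ≤ r) :
    ∫⁻ x, ‖reconstruct dt dx w (t, x) - reconstruct dt dx w (r, x)‖ₑ ≤
      ∑' i : ℕ, (Ico ((i + 1) * dt) ((i + 1) * dt + h)).indicator
        (fun _ => ENNReal.ofReal dx * V) t := by
  have ht : 0 ≤ t := hr.trans hrt
  have h1 : ∀ x, ‖reconstruct dt dx w (t, x) - reconstruct dt dx w (r, x)‖ₑ ≤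
      ∑' i : ℕ, (Ico ((i + 1) * dt) ((i + 1) * dt + h)).indicator
      (fun _ => ENNReal.ofReal |w (i + 1) ⌊x / dx⌋ - w i ⌊x / dx⌋|) t := fun x => by
    simp only [reconstruct, ht, hr, if_true]
    exact enorm_sub_le_tsum_indicator_nat hdt (fun n => w n ⌊x / dx⌋) hr hrt htr
  refine (lintegral_mono h1).trans ?_
  rw [lintegral_tsum]
  · refine ENNReal.tsum_le_tsum fun i => ?_
    by_cases hm : t ∈ Ico ((i + 1) * dt) ((i + 1) * dt + h)
    · simp only [indicator_of_mem hm]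
      exact (lintegral_floor_le hdx fun j => ENNReal.ofReal |w (i + 1) j - w i j|).trans
        (mul_le_mul_right (hw i) _)
    · simp [indicator_of_notMem hm]
  · intro i
    have : Measurable fun j : ℤ => (Ico (((i : ℝ) + 1) * dt) ((i + 1) * dt + h)).indicator
      (fun _ => ENNReal.ofReal |w (i + 1) j - w i j|) t := Measurable.of_discrete
    exact (this.comp (Int.measurable_floor.comp (measurable_id.div_const dx))).aemeasurable

theorem lintegral_tsum_indicator_le (hdt : 0 < dt) (hT : 0 ≤ T) {S : Set ℝ}
    (hS : MeasurableSet S) (hST : S ⊆ Iio T) (A : ℝ≥0∞) :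
    ∫⁻ t in S, ∑' i : ℕ, (Ico ((i + 1) * dt) ((i + 1) * dt + h)).indicator (fun _ => A) t ≤
      ENNReal.ofReal (T / dt) * (ENNReal.ofReal h * A) := by
  rw [lintegral_tsum fun j => (measurable_const.indicator measurableSet_Ico).aemeasurable]
  have h1 : ∀ i : ℕ, ∫⁻ t in S, (Ico (((i : ℝ) + 1) * dt) ((i + 1) * dt + h)).indicator
      (fun _ => A) t ≤ ENNReal.ofReal h * A := fun i => by
    refine (setLIntegral_le_lintegral S _).trans ?_
    rw [lintegral_indicator measurableSet_Ico, lintegral_const, Measure.restrict_apply_univ,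
      Real.volume_Ico, mul_comm, add_sub_cancel_left]
  -- The jump with index i occurs at (i + 1) dt, so at most T / dt jumps occur up to time T.
  have h2 : ∀ i ∉ Finset.range ⌊T / dt⌋₊,
      ∫⁻ t in S, (Ico (((i : ℝ) + 1) * dt) ((i + 1) * dt + h)).indicator (fun _ => A) t = 0 := by
    intro i hi
    rw [Finset.mem_range, not_lt] at hi
    have h3 : T < (i + 1) * dt := by
      have : T / dt < i + 1 := by exact_mod_cast (Nat.floor_lt (by positivity)).1 (by omega)
      exact (div_lt_iff₀ hdt).1 this
    rw [setLIntegral_congr_fun (g := fun _ => 0) hS, lintegral_zero]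
    intro t ht
    refine indicator_of_notMem (fun hm => ?_) _
    have := hST ht
    exact absurd (hm.1.trans_lt this) (by linarith)
  rw [tsum_eq_sum h2]
  refine (Finset.sum_le_card_nsmul _ _ _ fun i _ => h1 i).trans ?_
  rw [Finset.card_range, nsmul_eq_mul]
  refine mul_le_mul_left ?_ _
  rw [← ENNReal.ofReal_natCast]
  exact ENNReal.ofReal_le_ofReal (Nat.floor_le (by positivity))

/-- `L¹` modulus of continuity in time of step functions. -/
theorem lintegral_reconstruct_time_le (hdt : 0 < dt) (hdx : 0 < dx) (hT : 0 ≤ T)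
    (hw : ∀ n, ∑' j, ENNReal.ofReal |w (n + 1) j - w n j| ≤ V) {S : Set ℝ}
    (hS : MeasurableSet S) (hST : S ⊆ Iio T) {r : ℝ → ℝ}
    (hr : ∀ t ∈ S, 0 ≤ r t) (hrt : ∀ t ∈ S, r t ≤ t) (htr : ∀ t ∈ S, t - h ≤ r t) :
    ∫⁻ t in S, ∫⁻ x, ‖reconstruct dt dx w (t, x) - reconstruct dt dx w (r t, x)‖ₑ ≤
      ENNReal.ofReal (T / dt) * (ENNReal.ofReal h * (ENNReal.ofReal dx * V)) := by
  refine le_trans (setLIntegral_mono' hS fun t ht =>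
    lintegral_reconstruct_time_slice_le hdt hdx hw (hr t ht) (hrt t ht) (htr t ht)) ?_
  exact lintegral_tsum_indicator_le hdt hT hS hST _

/-- `L¹` distance of a step function to its samples at nearby points. -/
theorem lintegral_reconstruct_sub_le {lam : ℝ} (hdx : 0 < dx) (hlam : 0 < lam)
    (hT : 0 ≤ T)
    (hw : ∀ n, ∑' j, ENNReal.ofReal |w n (j + 1) - w n j| ≤ V)
    (hw' : ∀ n, ∑' j, ENNReal.ofReal |w (n + 1) j - w n j| ≤ V) {S : Set ℝ}
    (hS : MeasurableSet S) (hST : S ⊆ Ico 0 T) {r y : ℝ → ℝ} (hrm : Measurable r)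
    (hym : Measurable y)
    (hr : ∀ t ∈ S, 0 ≤ r t) (hrt : ∀ t ∈ S, r t ≤ t) (htr : ∀ t ∈ S, t - h ≤ r t)
    (hy : ∀ x, y x ≤ x) (hy' : ∀ x, x - h ≤ y x) :
    ∫⁻ p in S ×ˢ univ, ‖reconstruct (dx / lam) dx w p -
        reconstruct (dx / lam) dx w (r p.1, y p.2)‖ₑ ≤
      ENNReal.ofReal h * (ENNReal.ofReal ((1 + lam) * T) * V) := by
  set g := reconstruct (dx / lam) dx w with hg
  have hgm : Measurable g := measurable_reconstruct _ _ _
  have hdt : 0 < dx / lam := by positivity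
  rw [Measure.volume_eq_prod, ← Measure.prod_restrict, Measure.restrict_univ, lintegral_prod _
    (by fun_prop)]
  -- The intermediate point (r t, x) separates the time increment from the space increment. The
  -- former costs (T / dt) Δx = λT and the latter T, whence the constant (1 + λ)T.
  have h1 : ∀ t, ∫⁻ x, ‖g (t, x) - g (r t, y x)‖ₑ ≤
      (∫⁻ x, ‖g (t, x) - g (r t, x)‖ₑ) + ENNReal.ofReal h * V := fun t => by
    refine le_trans ?_ (add_le_add_right
      (lintegral_reconstruct_space_le (dt := dx / lam) hdx hw (r t) hy hy') _)
    rw [← lintegral_add_left (by fun_prop)]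
    refine lintegral_mono fun x => ?_
    have : g (t, x) - g (r t, y x) = (g (t, x) - g (r t, x)) + (g (r t, x) - g (r t, y x)) := by
      ring
    simp only [this]
    exact enorm_add_le _ _
  refine (lintegral_mono h1).trans ?_
  rw [lintegral_add_right _ measurable_const, lintegral_const, Measure.restrict_apply_univ]
  have h2 : volume S ≤ ENNReal.ofReal T := by
    refine (measure_mono hST).trans ?_
    rw [Real.volume_Ico, sub_zero]
  have h3 := lintegral_reconstruct_time_le hdt hdx hT hw' hS (fun t ht => (hST ht).2) hr hrt htr
  refine (add_le_add h3 (mul_le_mul_right h2 _)).trans (le_of_eq ?_)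
  have e : ENNReal.ofReal ((1 + lam) * T) =
      ENNReal.ofReal (T / (dx / lam)) * ENNReal.ofReal dx + ENNReal.ofReal T := by
    rw [← ENNReal.ofReal_mul (by positivity), ← ENNReal.ofReal_add (by positivity) hT]
    congr 1
    field_simp
    ring
  rw [e]
  ring

end StepFunctions

/-! ### Compactness -/

/-- An equivalent finite measure keeps the null sets, makes constants integrable and makes late
times negligible, so L¹ arguments work on the whole plane at once. -/
theorem exists_finiteMeasure_le_volume :
    ∃ ν : Measure (ℝ × ℝ), IsFiniteMeasure ν ∧ ν ≤ volume ∧ (volume : Measure (ℝ × ℝ)) ≪ ν := by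
  obtain ⟨w, hw0, hwm, hw⟩ := exists_pos_lintegral_lt_of_sigmaFinite
    (volume : Measure (ℝ × ℝ)) (ε := 1) one_ne_zero
  let f : ℝ × ℝ → ℝ≥0∞ := fun p => min (w p) 1
  have hf : Measurable f := hwm.coe_nnreal_ennreal.min measurable_const
  refine ⟨volume.withDensity f, ?_, ?_, ?_⟩
  · refine isFiniteMeasure_withDensity (ne_top_of_lt (lt_of_le_of_lt ?_ hw))
    exact lintegral_mono fun p => min_le_left _ _
  · calc volume.withDensity f ≤ volume.withDensity 1 :=
          withDensity_mono (ae_of_all _ fun p => min_le_right _ _)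
      _ = volume := withDensity_one
  · refine withDensity_absolutelyContinuous' hf.aemeasurable (ae_of_all _ fun p => ?_)
    have : 0 < w p := hw0 p
    simp [f, this.ne', min_eq_iff]

/-- A point of the lattice with mesh size `1 / (m + 1)` below `x`. -/
def latticePoint (m : ℕ) (x : ℝ) : ℝ := ((⌊x * (m + 1)⌋ / (m + 1) : ℚ) : ℝ)

theorem measurable_latticePoint (m : ℕ) : Measurable (latticePoint m) := by
  have h1 : Measurable fun j : ℤ => ((j / (m + 1) : ℚ) : ℝ) := Measurable.of_discrete
  exact h1.comp (Int.measurable_floor.comp (measurable_id.mul_const _))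

theorem latticePoint_le (m : ℕ) (x : ℝ) : latticePoint m x ≤ x := by
  unfold latticePoint
  push_cast
  rw [div_le_iff₀ (by positivity)]
  exact Int.floor_le _

theorem sub_le_latticePoint (m : ℕ) (x : ℝ) : x - 1 / (m + 1) ≤ latticePoint m x := by
  unfold latticePoint
  push_cast
  have := Int.lt_floor_add_one (x * (m + 1))
  have hm : (0 : ℝ) < m + 1 := by positivity
  rw [le_div_iff₀ hm, sub_mul, one_div, inv_mul_cancel₀ hm.ne']
  linarith

theorem latticePoint_nonneg (m : ℕ) {x : ℝ} (hx : 0 ≤ x) : 0 ≤ latticePoint m x := by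
  unfold latticePoint
  push_cast
  have : (0 : ℤ) ≤ ⌊x * (m + 1)⌋ := Int.floor_nonneg.2 (by positivity)
  have : (0 : ℝ) ≤ ⌊x * (m + 1)⌋ := by exact_mod_cast this
  positivity

theorem latticePoint_neg (m : ℕ) {x : ℝ} (hx : x < 0) : latticePoint m x < 0 :=
  (latticePoint_le m x).trans_lt hx

/-- This is the diagonal argument, in the form of sequential compactness of a countable product of
compact intervals. -/
theorem exists_subseq_tendsto_rat {g : ℕ → ℝ × ℝ → ℝ} {C : ℝ} (hC : ∀ k p, |g k p| ≤ C) :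
    ∃ κ : ℕ → ℕ, StrictMono κ ∧ ∃ a : ℚ × ℚ → ℝ, ∀ q : ℚ × ℚ,
      Tendsto (fun k => g (κ k) (q.1, q.2)) atTop (𝓝 (a q)) := by
  let x : ℕ → ℚ × ℚ → Icc (-C) C := fun k q => ⟨g k (q.1, q.2), abs_le.1 (hC _ _)⟩
  obtain ⟨a, κ, hκ, ha⟩ := CompactSpace.tendsto_subseq x
  refine ⟨κ, hκ, fun q => a q, fun q => ?_⟩
  exact (continuous_subtype_val.tendsto _).comp ((tendsto_pi_nhds.1 ha) q)

theorem tendsto_measure_late (ν : Measure (ℝ × ℝ)) [IsFiniteMeasure ν] :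
    Tendsto (fun n : ℕ => ν {p | (n : ℝ) ≤ p.1}) atTop (𝓝 0) := by
  have h := tendsto_measure_iInter_atTop (μ := ν) (s := fun n : ℕ => {p : ℝ × ℝ | (n : ℝ) ≤ p.1})
    (fun n => (measurableSet_le measurable_const measurable_fst).nullMeasurableSet)
    (fun m n hmn p (hp : (n : ℝ) ≤ p.1) =>
      show (m : ℝ) ≤ p.1 from le_trans (by exact_mod_cast hmn) hp)
    ⟨0, measure_ne_top _ _⟩
  have e : ⋂ n : ℕ, {p : ℝ × ℝ | (n : ℝ) ≤ p.1} = ∅ := by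
    refine eq_empty_of_forall_notMem fun p hp => ?_
    obtain ⟨n, hn⟩ := exists_nat_gt p.1
    exact absurd (mem_iInter.1 hp n) (not_le.2 hn)
  rwa [e, measure_empty] at h

/-- Bounded sequences with a uniform `L¹` sampling estimate have almost everywhere convergent
subsequences. -/
theorem exists_subseq_ae_tendsto {g : ℕ → ℝ × ℝ → ℝ} (hm : ∀ k, Measurable (g k)) {C : ℝ}
    (hC : ∀ k p, |g k p| ≤ C) (hneg : ∀ k p, p.1 < 0 → g k p = 0) {A : ℝ → ℝ≥0∞}
    (hA : ∀ T, A T ≠ ⊤)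
    (hs : ∀ T, 0 ≤ T → ∀ m k, ∫⁻ p in Ico 0 T ×ˢ univ,
      ‖g k p - g k (latticePoint m p.1, latticePoint m p.2)‖ₑ ≤
        ENNReal.ofReal (1 / (m + 1)) * A T) :
    ∃ κ : ℕ → ℕ, StrictMono κ ∧ ∃ G : ℝ × ℝ → ℝ, Measurable G ∧ (∀ p, |G p| ≤ C) ∧
      ∀ᵐ p, Tendsto (fun k => g (κ k) p) atTop (𝓝 (G p)) := by
  obtain ⟨κ₀, hκ₀, a, ha⟩ := exists_subseq_tendsto_rat hC
  obtain ⟨ν, hν, hνle, hνac⟩ := exists_finiteMeasure_le_volume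
  let I : ℕ → ℝ × ℝ → ℝ × ℝ := fun m p => (latticePoint m p.1, latticePoint m p.2)
  have hI : ∀ m, Measurable (I m) := fun m =>
    ((measurable_latticePoint m).comp measurable_fst).prodMk
      ((measurable_latticePoint m).comp measurable_snd)
  have hdiff : ∀ k p q, ‖g k p - g k q‖ₑ ≤ ENNReal.ofReal (2 * C) := fun k p q => by
    rw [← ofReal_norm, Real.norm_eq_abs]
    exact ENNReal.ofReal_le_ofReal (by linarith [abs_sub (g k p) (g k q), hC k p, hC k q])
  -- One lattice serves all k: late times have small ν-mass, the sampling estimate covers the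
  -- remaining strip, and at negative times both functions vanish.
  have hsample : ∀ ε : ℝ≥0∞, 0 < ε → ∃ m, ∀ k, ∫⁻ p, ‖g k p - g k (I m p)‖ₑ ∂ν ≤ ε := by
    intro ε hε
    have hε2 : 0 < ε / 2 := ENNReal.half_pos hε.ne'
    obtain ⟨n, hn⟩ : ∃ n : ℕ, ENNReal.ofReal (2 * C) * ν {p | (n : ℝ) ≤ p.1} < ε / 2 := by
      have := ENNReal.Tendsto.const_mul (tendsto_measure_late ν)
        (Or.inr (ENNReal.ofReal_ne_top (r := 2 * C)))
      rw [mul_zero] at this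
      exact (this.eventually (gt_mem_nhds hε2)).exists
    obtain ⟨m, hm'⟩ : ∃ m : ℕ, ENNReal.ofReal (1 / ((m : ℝ) + 1)) * A n < ε / 2 := by
      have h1 := ENNReal.tendsto_ofReal (tendsto_one_div_add_atTop_nhds_zero_nat (𝕜 := ℝ))
      have := ENNReal.Tendsto.mul_const h1 (Or.inr (hA n))
      rw [ENNReal.ofReal_zero, zero_mul] at this
      exact (this.eventually (gt_mem_nhds hε2)).exists
    refine ⟨m, fun k => ?_⟩
    have hS1 : MeasurableSet (Ico (0 : ℝ) n ×ˢ (univ : Set ℝ)) :=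
      measurableSet_Ico.prod MeasurableSet.univ
    have hS2 : MeasurableSet {p : ℝ × ℝ | (n : ℝ) ≤ p.1} :=
      measurableSet_le measurable_const measurable_fst
    have hle : ∀ p, ‖g k p - g k (I m p)‖ₑ ≤
        (Ico (0 : ℝ) n ×ˢ univ).indicator (fun p => ‖g k p - g k (I m p)‖ₑ) p +
          {p : ℝ × ℝ | (n : ℝ) ≤ p.1}.indicator (fun _ => ENNReal.ofReal (2 * C)) p := fun p => by
      rcases lt_or_ge p.1 0 with hp | hp
      · rw [hneg k p hp, hneg k (I m p) (latticePoint_neg m hp)]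
        simp
      rcases lt_or_ge p.1 n with hp' | hp'
      · rw [indicator_of_mem (by exact ⟨⟨hp, hp'⟩, mem_univ _⟩)]
        exact le_self_add
      · rw [indicator_of_mem (s := {p : ℝ × ℝ | (n : ℝ) ≤ p.1}) hp']
        exact (hdiff _ _ _).trans le_add_self
    refine (lintegral_mono hle).trans ?_
    rw [lintegral_add_right _ (measurable_const.indicator hS2), lintegral_indicator hS1,
      lintegral_indicator hS2, lintegral_const, Measure.restrict_apply_univ, ← ENNReal.add_halves ε]
    refine add_le_add ?_ hn.le
    refine le_trans (lintegral_mono' (Measure.restrict_mono_measure hνle _) le_rfl) ?_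
    exact (hs n (Nat.cast_nonneg n) m k).trans hm'.le
  -- Lattice points are rational, so the sampled functions converge at every point.
  have hsampleconv : ∀ m, ∃ L : ℝ × ℝ → ℝ, Measurable L ∧
      Tendsto (fun k => ∫⁻ p, ‖g (κ₀ k) (I m p) - L p‖ₑ ∂ν) atTop (𝓝 0) := by
    intro m
    have hlim : ∀ p, Tendsto (fun k => g (κ₀ k) (I m p)) atTop
        (𝓝 (a (⌊p.1 * (m + 1)⌋ / (m + 1), ⌊p.2 * (m + 1)⌋ / (m + 1)))) := fun p => ha _
    have hLm := measurable_of_tendsto_metrizable (fun k => (hm (κ₀ k)).comp (hI m))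
      (tendsto_pi_nhds.2 hlim)
    refine ⟨_, hLm, ?_⟩
    have h0 : ∫⁻ _ : ℝ × ℝ, (0 : ℝ≥0∞) ∂ν = 0 := lintegral_zero
    rw [← h0]
    refine tendsto_lintegral_of_dominated_convergence (fun _ => ENNReal.ofReal (2 * C))
      (fun k => (((hm _).comp (hI m)).sub hLm).enorm) (fun k => ae_of_all _ fun p => ?_) ?_
      (ae_of_all _ fun p => ?_)
    · have hb : |a (⌊p.1 * (m + 1)⌋ / (m + 1), ⌊p.2 * (m + 1)⌋ / (m + 1))| ≤ C :=
        le_of_tendsto' (hlim p).abs fun k => hC _ _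
      simp only
      rw [← ofReal_norm, Real.norm_eq_abs]
      refine ENNReal.ofReal_le_ofReal ((abs_sub _ _).trans ?_)
      linarith [hC (κ₀ k) (I m p)]
    · rw [lintegral_const]
      exact ENNReal.mul_ne_top ENNReal.ofReal_ne_top (measure_ne_top _ _)
    · have := ((hlim p).sub_const (a (⌊p.1 * (m + 1)⌋ / (m + 1), ⌊p.2 * (m + 1)⌋ / (m + 1)))).enorm
      simpa using this
  have hcauchy : ∀ ε : ℝ≥0∞, 0 < ε → ∀ᶠ N in atTop, ∀ k l, N ≤ k → N ≤ l →
      eLpNorm (g (κ₀ k) - g (κ₀ l)) 1 ν < ε := by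
    intro ε hε
    obtain ⟨ε', hε', hεε⟩ := exists_between (ENNReal.div_pos hε.ne' (by norm_num : (4 : ℝ≥0∞) ≠ ⊤))
    obtain ⟨m, hm'⟩ := hsample ε' hε'
    obtain ⟨L, hLm, hL⟩ := hsampleconv m
    obtain ⟨N, hN⟩ := eventually_atTop.1 (hL.eventually (gt_mem_nhds hε'))
    have hnear : ∀ k, N ≤ k → ∫⁻ p, ‖g (κ₀ k) p - L p‖ₑ ∂ν ≤ ε' + ε' := fun k hk => by
      refine le_trans ?_ (add_le_add (hm' (κ₀ k)) (hN k hk).le)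
      rw [← lintegral_add_left (by exact ((hm _).sub ((hm _).comp (hI m))).enorm)]
      refine lintegral_mono fun p => ?_
      simp only
      rw [← sub_add_sub_cancel (g (κ₀ k) p) (g (κ₀ k) (I m p)) (L p)]
      exact enorm_add_le _ _
    refine eventually_atTop.2 ⟨N, fun N' hN' k l hk hl => ?_⟩
    rw [eLpNorm_one_eq_lintegral_enorm]
    calc ∫⁻ p, ‖(g (κ₀ k) - g (κ₀ l)) p‖ₑ ∂ν
        ≤ ∫⁻ p, (‖g (κ₀ k) p - L p‖ₑ + ‖g (κ₀ l) p - L p‖ₑ) ∂ν := by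
          refine lintegral_mono fun p => ?_
          rw [Pi.sub_apply, ← sub_sub_sub_cancel_right _ _ (L p)]
          exact enorm_sub_le
      _ ≤ (ε' + ε') + (ε' + ε') := by
          rw [lintegral_add_left (by exact ((hm _).sub hLm).enorm)]
          exact add_le_add (hnear k (hN'.trans hk)) (hnear l (hN'.trans hl))
      _ = 4 * ε' := by ring
      _ < ε := by
          rw [mul_comm]
          exact (ENNReal.lt_div_iff_mul_lt (Or.inl (by norm_num)) (Or.inl (by norm_num))).1 hεε
  -- Summable Cauchy bounds 2⁻ⁿ turn L¹ convergence into almost everywhere convergence.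
  obtain ⟨κ₁, hκ₁, hc⟩ := extraction_forall_of_eventually
    (P := fun n N => ∀ k l, N ≤ k → N ≤ l →
      eLpNorm (g (κ₀ k) - g (κ₀ l)) 1 ν < (2⁻¹ : ℝ≥0∞) ^ n)
    fun n => hcauchy _ (ENNReal.pow_pos (by norm_num) n)
  have hae : ∀ᵐ p ∂ν, ∃ l, Tendsto (fun k => g (κ₀ (κ₁ k)) p) atTop (𝓝 l) :=
    Lp.ae_tendsto_of_cauchy_eLpNorm (fun k => (hm _).aestronglyMeasurable) le_rfl
      (B := fun n => (2⁻¹ : ℝ≥0∞) ^ n) (by rw [ENNReal.tsum_geometric]; norm_num)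
      fun N n m' hn hm'' => hc N _ _ (hκ₁.monotone hn) (hκ₁.monotone hm'')
  obtain ⟨G, hGm, hG⟩ := measurable_limit_of_tendsto_metrizable_ae
    (fun k => (hm (κ₀ (κ₁ k))).aemeasurable) (hνac.ae_le hae)
  have hC0 : 0 ≤ C := (abs_nonneg _).trans (hC 0 0)
  -- Clipping changes the limit only on a null set and makes its bound hold everywhere.
  refine ⟨κ₀ ∘ κ₁, hκ₀.comp hκ₁, fun p => max (-C) (min C (G p)),
    measurable_const.max (measurable_const.min hGm), fun p => ?_, ?_⟩
  · exact abs_le.2 ⟨le_max_left _ _, max_le (by linarith) (min_le_left _ _)⟩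
  · filter_upwards [hG] with p hp
    have hb := abs_le.1 (le_of_tendsto' hp.abs fun k => hC (κ₀ (κ₁ k)) p)
    rw [min_eq_right hb.2, max_eq_right hb.1]
    exact hp

theorem measurableSet_halfPlane : MeasurableSet halfPlane :=
  measurableSet_Ici.prod MeasurableSet.univ

theorem memLp_top_of_abs_le {α : Type*} [MeasurableSpace α] {μ : Measure α} {f : α → ℝ}
    (hf : Measurable f) {C : ℝ} (hC : ∀ p, |f p| ≤ C) : MemLp f ⊤ μ :=
  memLp_top_of_bound hf.aestronglyMeasurable C (ae_of_all _ hC)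

theorem locallyIntegrable_of_abs_le {f : ℝ × ℝ → ℝ} (hf : Measurable f) {C : ℝ}
    (hC : ∀ p, |f p| ≤ C) : LocallyIntegrable f :=
  (memLp_top_of_abs_le hf hC).locallyIntegrable le_top

theorem tendstoL1Loc_of_ae_tendsto {f : ℕ → ℝ × ℝ → ℝ} {g : ℝ × ℝ → ℝ} {C : ℝ}
    (hf : ∀ k, Measurable (f k)) (hg : Measurable g) (hfC : ∀ k p, |f k p| ≤ C)
    (hgC : ∀ p, |g p| ≤ C) (h : ∀ᵐ p, Tendsto (fun k => f k p) atTop (𝓝 (g p)))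
    (S : Set (ℝ × ℝ)) : TendstoL1Loc f g S := by
  refine ⟨fun k => (locallyIntegrable_of_abs_le (hf k) (hfC k)).locallyIntegrableOn S,
    (locallyIntegrable_of_abs_le hg hgC).locallyIntegrableOn S, fun K hK _ => ?_⟩
  simp only [eLpNorm_one_eq_lintegral_enorm]
  have h0 : ∫⁻ _ in K, (0 : ℝ≥0∞) ∂(volume : Measure (ℝ × ℝ)) = 0 := lintegral_zero
  rw [← h0]
  refine tendsto_lintegral_of_dominated_convergence (fun _ => ENNReal.ofReal (2 * C))
    (fun k => ((hf k).sub hg).enorm) (fun k => ae_of_all _ fun p => ?_) ?_ ?_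
  · simp only [Pi.sub_apply]
    rw [← ofReal_norm, Real.norm_eq_abs]
    refine ENNReal.ofReal_le_ofReal ((abs_sub _ _).trans ?_)
    linarith [hfC k p, hgC p]
  · rw [lintegral_const, Measure.restrict_apply_univ]
    exact ENNReal.mul_ne_top ENNReal.ofReal_ne_top hK.measure_lt_top.ne
  · filter_upwards [ae_restrict_of_ae h] with p hp
    simpa using (hp.sub_const (g p)).enorm

/-! ### Difference quotients of test functions -/

section DifferenceQuotients

variable {ψ : ℝ × ℝ → ℝ}

theorem exists_norm_bound_of_hasCompactSupport (hc : HasCompactSupport ψ) :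
    ∃ R : ℝ, 0 ≤ R ∧ ∀ p, R < ‖p‖ → ψ p = 0 := by
  obtain ⟨R, hR⟩ := hc.isCompact.isBounded.subset_closedBall 0
  refine ⟨max R 0, le_max_right _ _, fun p hp => image_eq_zero_of_notMem_tsupport fun hm => ?_⟩
  have := mem_closedBall_zero_iff.1 (hR hm)
  linarith [le_max_left R 0]

/-- Used with a constant sequence G for the BV bound and with the relaxed kinetic variables for the
weak form. For steps below 1 the quotients are dominated by the Lipschitz constant on a ball
enlarged by ‖e‖. -/
theorem tendsto_integral_mul_difference_quotient (μ : Measure (ℝ × ℝ))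
    [IsFiniteMeasureOnCompacts μ] (hψ : ContDiff ℝ 1 ψ) (hc : HasCompactSupport ψ) (e : ℝ × ℝ)
    {b : ℕ → ℝ} (hb : ∀ k, 0 < b k) (hb0 : Tendsto b atTop (𝓝 0)) {G : ℕ → ℝ × ℝ → ℝ}
    {g : ℝ × ℝ → ℝ} {C : ℝ} (hG : ∀ k, Measurable (G k)) (hGC : ∀ k p, |G k p| ≤ C)
    (hlim : ∀ᵐ p ∂μ, Tendsto (fun k => G k p) atTop (𝓝 (g p))) :
    Tendsto (fun k => ∫ p, G k p * ((b k)⁻¹ * (ψ (p + b k • e) - ψ p)) ∂μ) atTop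
      (𝓝 (∫ p, g p * fderiv ℝ ψ p e ∂μ)) := by
  obtain ⟨K, hK⟩ := hψ.lipschitzWith_of_hasCompactSupport hc one_ne_zero
  obtain ⟨R, hR0, hR⟩ := exists_norm_bound_of_hasCompactSupport hc
  have hC0 : 0 ≤ C := (abs_nonneg _).trans (hGC 0 0)
  have hψc := hψ.continuous
  refine tendsto_integral_filter_of_dominated_convergence
    ((Metric.closedBall (0 : ℝ × ℝ) (R + ‖e‖)).indicator fun _ => C * (K * ‖e‖)) ?_ ?_ ?_ ?_
  · refine Eventually.of_forall fun k => ((hG k).mul ?_).aestronglyMeasurable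
    exact Continuous.measurable (by fun_prop)
  · filter_upwards [hb0.eventually (gt_mem_nhds one_pos)] with k hk
    refine ae_of_all _ fun p => ?_
    by_cases hp : p ∈ Metric.closedBall (0 : ℝ × ℝ) (R + ‖e‖)
    · rw [indicator_of_mem hp, norm_mul, norm_mul, norm_inv, Real.norm_of_nonneg (hb k).le]
      refine mul_le_mul (hGC k p) ?_ (mul_nonneg (inv_nonneg.2 (hb k).le) (norm_nonneg _)) hC0
      have := hK.dist_le_mul (p + b k • e) p
      rw [dist_eq_norm, dist_eq_norm, add_sub_cancel_left, norm_smul,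
        Real.norm_of_nonneg (hb k).le] at this
      rw [inv_mul_le_iff₀ (hb k)]
      linarith
    · rw [indicator_of_notMem hp]
      rw [mem_closedBall_zero_iff, not_le] at hp
      have h1 : R < ‖p‖ := by linarith [norm_nonneg e]
      have h2 : R < ‖p + b k • e‖ := by
        have h3 := norm_sub_norm_le p (-(b k • e))
        rw [sub_neg_eq_add, norm_neg, norm_smul, Real.norm_of_nonneg (hb k).le] at h3
        nlinarith [norm_nonneg e]
      simp [hR _ h1, hR _ h2]
  · rw [integrable_indicator_iff Metric.isClosed_closedBall.measurableSet]
    exact integrableOn_const (isCompact_closedBall _ _).measure_lt_top.ne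
  · filter_upwards [hlim] with p hp
    refine hp.mul ?_
    have hd := (hψ.differentiable (by norm_num) p).hasFDerivAt
    have hinv : Tendsto (fun k => ‖(b k)⁻¹‖) atTop atTop := by
      have : Tendsto (fun k => (b k)⁻¹) atTop atTop :=
        tendsto_inv_nhdsGT_zero.comp
          (tendsto_nhdsWithin_iff.2 ⟨hb0, Eventually.of_forall hb⟩)
      exact tendsto_norm_atTop_atTop.comp this
    have := hd.lim e hinv
    simpa only [inv_inv, smul_eq_mul] using this

theorem integrable_mul_of_abs_le {g : ℝ × ℝ → ℝ} {C : ℝ} {μ : Measure (ℝ × ℝ)}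
    [IsFiniteMeasureOnCompacts μ] (hg : Measurable g)
    (hgC : ∀ p, |g p| ≤ C) {η : ℝ × ℝ → ℝ} (hη : Continuous η) (hc : HasCompactSupport η) :
    Integrable (fun p => g p * η p) μ :=
  (hη.integrable_of_hasCompactSupport hc).bdd_mul hg.aestronglyMeasurable (ae_of_all _ hgC)

theorem integral_mul_difference_quotient_le {g : ℝ × ℝ → ℝ} {C : ℝ} (hg : Measurable g)
    (hgC : ∀ p, |g p| ≤ C) (hψ : Continuous ψ) (hc : HasCompactSupport ψ)
    (hψ1 : ∀ p, |ψ p| ≤ 1) {S : Set (ℝ × ℝ)} (hS : MeasurableSet S)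
    (hψS : ∀ p ∉ S, ψ p = 0) {b : ℝ} (hb : 0 < b) (e : ℝ × ℝ) {A : ℝ≥0∞} (hA : A ≠ ⊤)
    (hgA : ∫⁻ p in S, ‖g p - g (p - b • e)‖ₑ ≤ ENNReal.ofReal b * A) :
    ∫ p, g p * (b⁻¹ * (ψ (p + b • e) - ψ p)) ≤ A.toReal := by
  have hgt : Measurable fun p => g (p - b • e) := hg.comp (measurable_id.sub_const _)
  have i1 : Integrable fun p => g p * ψ p := integrable_mul_of_abs_le hg hgC hψ hc
  have i2 : Integrable fun p => g (p - b • e) * ψ p :=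
    integrable_mul_of_abs_le hgt (fun p => hgC _) hψ hc
  have i3 : Integrable fun p => g p * ψ (p + b • e) := by
    simpa using i2.comp_add_right (b • e)
  have e1 : ∫ p, g p * ψ (p + b • e) = ∫ p, g (p - b • e) * ψ p := by
    simpa using integral_add_right_eq_self (μ := volume) (fun p => g (p - b • e) * ψ p) (b • e)
  have e2 : ∫ p, g p * (b⁻¹ * (ψ (p + b • e) - ψ p)) =
      b⁻¹ * ∫ p, (g (p - b • e) - g p) * ψ p := by
    simp_rw [sub_mul]
    rw [integral_sub i2 i1, ← e1, ← integral_sub i3 i1, ← integral_const_mul]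
    exact integral_congr_ae (ae_of_all _ fun p => by ring)
  rw [e2, inv_mul_le_iff₀ hb]
  have h1 : ‖∫ p, (g (p - b • e) - g p) * ψ p‖ₑ ≤ ENNReal.ofReal b * A := by
    refine (enorm_integral_le_lintegral_enorm _).trans (le_trans ?_ hgA)
    rw [← lintegral_indicator hS]
    refine lintegral_mono fun p => ?_
    by_cases hp : p ∈ S
    · rw [indicator_of_mem hp, enorm_mul, enorm_sub_rev]
      refine mul_le_of_le_one_right' ?_
      rw [← ofReal_norm, Real.norm_eq_abs]
      exact ENNReal.ofReal_le_one.2 (hψ1 p)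
    · simp [hψS p hp]
  have h2 := ENNReal.toReal_mono (ENNReal.mul_ne_top ENNReal.ofReal_ne_top hA) h1
  rw [toReal_enorm, ENNReal.toReal_mul, ENNReal.toReal_ofReal hb.le] at h2
  exact (le_abs_self _).trans h2

/-- A compact set in the open strip stays away from t = 0, so small backward translations of its
points keep t ≥ 0. -/
theorem exists_tsupport_subset_Ico {T : ℝ} (hc : HasCompactSupport ψ)
    (hs : tsupport ψ ⊆ strip T) : ∃ δ > 0, ∀ p, p.1 < δ ∨ T ≤ p.1 → ψ p = 0 := by
  rcases (tsupport ψ).eq_empty_or_nonempty with h | h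
  · refine ⟨1, one_pos, fun p _ => image_eq_zero_of_notMem_tsupport ?_⟩
    rw [h]; exact notMem_empty p
  · obtain ⟨q, hq, hmin⟩ := hc.isCompact.exists_isMinOn h continuous_fst.continuousOn
    refine ⟨q.1, (hs hq).1.1, fun p hp => image_eq_zero_of_notMem_tsupport fun hm => ?_⟩
    rcases hp with hp | hp
    · exact absurd (hmin hm) (not_le.2 hp)
    · exact absurd (hs hm).1.2 (not_lt.2 hp)

theorem setIntegral_strip_mul_fderiv_le {g : ℝ × ℝ → ℝ} {C T : ℝ} (hg : Measurable g)
    (hgC : ∀ p, |g p| ≤ C) (hψ : ContDiff ℝ 1 ψ) (hc : HasCompactSupport ψ)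
    (hs : tsupport ψ ⊆ strip T) (hψ1 : ∀ p, |ψ p| ≤ 1) (e : ℝ × ℝ) {A : ℝ≥0∞} (hA : A ≠ ⊤)
    (hgA : ∀ b, 0 < b → ∫⁻ p in Ico b T ×ˢ univ, ‖g p - g (p - b • e)‖ₑ ≤ ENNReal.ofReal b * A) :
    ∫ p in strip T, g p * fderiv ℝ ψ p e ≤ A.toReal := by
  rw [setIntegral_eq_integral_of_forall_compl_eq_zero]
  · obtain ⟨δ, hδ, hδ0⟩ := exists_tsupport_subset_Ico hc hs
    have hb0 := tendsto_one_div_add_atTop_nhds_zero_nat (𝕜 := ℝ)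
    have hb : ∀ k : ℕ, 0 < 1 / ((k : ℝ) + 1) := fun k => by positivity
    refine le_of_tendsto (tendsto_integral_mul_difference_quotient volume hψ hc e hb hb0
      (G := fun _ => g) (fun _ => hg) (fun _ => hgC)
      (ae_of_all _ fun p => tendsto_const_nhds)) ?_
    filter_upwards [hb0.eventually (gt_mem_nhds hδ)] with k hk
    refine integral_mul_difference_quotient_le hg hgC hψ.continuous hc hψ1
      (measurableSet_Ico.prod MeasurableSet.univ) (fun p hp => hδ0 p ?_) (hb k) e hA (hgA _ (hb k))
    by_contra hcon
    rw [not_or, not_lt, not_le] at hcon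
    exact hp ⟨⟨hk.le.trans hcon.1, hcon.2⟩, mem_univ _⟩
  · intro p hp
    have : fderiv ℝ ψ p = 0 := by
      by_contra h0
      exact hp (hs (support_fderiv_subset ℝ h0))
    simp [this]

/-- Functions with Lipschitz `L¹` translations in both directions are of bounded variation. -/
theorem memBV2_of_translation {g : ℝ × ℝ → ℝ} {C T : ℝ} (hg : Measurable g)
    (hgC : ∀ p, |g p| ≤ C) {A : ℝ≥0∞} (hA : A ≠ ⊤)
    (hgT : ∀ b, 0 < b → ∫⁻ p in Ico b T ×ˢ univ, ‖g p - g (p - b • ((1, 0) : ℝ × ℝ))‖ₑ ≤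
      ENNReal.ofReal b * A)
    (hgX : ∀ b, 0 < b → ∫⁻ p in Ico b T ×ˢ univ, ‖g p - g (p - b • ((0, 1) : ℝ × ℝ))‖ₑ ≤
      ENNReal.ofReal b * A) : MemBV2 (strip T) g := by
  refine ⟨((memLp_top_of_bound hg.aestronglyMeasurable C
    (ae_of_all _ hgC)).locallyIntegrable le_top).locallyIntegrableOn _, ?_⟩
  refine lt_of_le_of_lt (b := ENNReal.ofReal (A.toReal + A.toReal)) (iSup₂_le fun F hF => ?_)
    ENNReal.ofReal_lt_top
  obtain ⟨h1, h2, c1, c2, s1, s2, hb⟩ := hF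
  refine ENNReal.ofReal_le_ofReal ?_
  have b1 : ∀ p, |F.1 p| ≤ 1 := fun p =>
    abs_le_one_iff_mul_self_le_one.2 (by nlinarith [hb p, sq_nonneg (F.2 p)])
  have b2 : ∀ p, |F.2 p| ≤ 1 := fun p =>
    abs_le_one_iff_mul_self_le_one.2 (by nlinarith [hb p, sq_nonneg (F.1 p)])
  have i : ∀ {ψ : ℝ × ℝ → ℝ} (e : ℝ × ℝ), ContDiff ℝ 1 ψ → HasCompactSupport ψ →
      IntegrableOn (fun p => g p * fderiv ℝ ψ p e) (strip T) := fun e hψ hc =>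
    (integrable_mul_of_abs_le hg hgC ((hψ.continuous_fderiv one_ne_zero).clm_apply
      continuous_const) (hc.fderiv_apply ℝ e)).integrableOn
  simp only [partialT, partialX, mul_add]
  rw [integral_add (i _ h1 c1) (i _ h2 c2)]
  exact add_le_add (setIntegral_strip_mul_fderiv_le hg hgC h1 c1 s1 b1 _ hA hgT)
    (setIntegral_strip_mul_fderiv_le hg hgC h2 c2 s2 b2 _ hA hgX)

/-- Fatou's lemma; almost everywhere convergence is preserved by translation. -/
theorem lintegral_translate_le_of_ae_tendsto {f : ℕ → ℝ × ℝ → ℝ} {g : ℝ × ℝ → ℝ}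
    (hf : ∀ k, Measurable (f k)) (h : ∀ᵐ p, Tendsto (fun k => f k p) atTop (𝓝 (g p)))
    (S : Set (ℝ × ℝ)) (v : ℝ × ℝ) {B : ℝ≥0∞}
    (hB : ∀ k, ∫⁻ p in S, ‖f k p - f k (p - v)‖ₑ ≤ B) :
    ∫⁻ p in S, ‖g p - g (p - v)‖ₑ ≤ B := by
  have hv : ∀ᵐ p, Tendsto (fun k => f k (p - v)) atTop (𝓝 (g (p - v))) :=
    (measurePreserving_sub_right volume v).quasiMeasurePreserving.ae h
  calc ∫⁻ p in S, ‖g p - g (p - v)‖ₑ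
      = ∫⁻ p in S, liminf (fun k => ‖f k p - f k (p - v)‖ₑ) atTop := by
        refine lintegral_congr_ae (ae_restrict_of_ae ?_)
        filter_upwards [h, hv] with p h1 h2
        exact ((h1.sub h2).enorm).liminf_eq.symm
    _ ≤ liminf (fun k => ∫⁻ p in S, ‖f k p - f k (p - v)‖ₑ) atTop :=
        lintegral_liminf_le fun k =>
          ((hf k).sub ((hf k).comp (measurable_id.sub_const v))).enorm
    _ ≤ B := liminf_le_of_le (by isBoundedDefault) fun c hc => by
        obtain ⟨k, hk⟩ := hc.exists
        exact hk.trans (hB k)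

end DifferenceQuotients

/-! ### The discrete conservation law -/

section WeakForm

/-- Exact transport along characteristics, tested against `ψ`. -/
theorem integral_reconstruct_transport {dt dx C : ℝ} (hdt : 0 < dt) (hdx : 0 < dx) (i : ℤ)
    {w z : ℕ → ℤ → ℝ} (hw : ∀ n j, |w n j| ≤ C) (hz : ∀ n j, w (n + 1) (j + i) = z n j)
    {ψ : ℝ × ℝ → ℝ} (hψ : Continuous ψ) (hc : HasCompactSupport ψ) :
    (∫ p, reconstruct dt dx z p * ψ (p + (dt, i * dx))) =
      (∫ p, reconstruct dt dx w p * ψ p) -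
        ∫ p in {p : ℝ × ℝ | p.1 < dt}, reconstruct dt dx w p * ψ p := by
  have hmeas := measurable_reconstruct dt dx w
  have hint : Integrable fun p => reconstruct dt dx w p * ψ p :=
    integrable_mul_of_abs_le hmeas (abs_reconstruct_le hw) hψ hc
  have hS : MeasurableSet {p : ℝ × ℝ | p.1 < dt} :=
    measurableSet_lt measurable_fst measurable_const
  -- The first layer t < dt has no predecessor and is removed; the shift by (dt, i dx) carries layer
  -- n onto layer n + 1.
  rw [← setIntegral_compl hS hint, ← integral_indicator hS.compl,
    ← integral_add_right_eq_self (μ := volume)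
      ({p : ℝ × ℝ | p.1 < dt}ᶜ.indicator fun p => reconstruct dt dx w p * ψ p)
      ((dt, i * dx) : ℝ × ℝ)]
  refine integral_congr_ae (ae_of_all _ fun p => ?_)
  simp only
  rcases lt_or_ge p.1 0 with hp | hp
  · rw [reconstruct_of_neg hp, zero_mul, indicator_of_notMem]
    rw [notMem_compl_iff]
    show p.1 + dt < dt
    linarith
  · rw [indicator_of_mem]
    · congr 1
      have h1 : (p.1 + dt) / dt = p.1 / dt + 1 := by field_simp
      have h2 : (p.2 + i * dx) / dx = p.2 / dx + i := by field_simp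
      have h3 : 0 ≤ p.1 + dt := by positivity
      simp only [reconstruct, hp, if_true, Prod.fst_add, Prod.snd_add, h1, h2, h3]
      rw [Nat.floor_add_one (by positivity), Int.floor_add_intCast, hz]
    · rw [mem_compl_iff]
      show ¬ (p.1 + dt < dt)
      linarith

theorem reconstruct_add (dt dx : ℝ) (w z : ℕ → ℤ → ℝ) (p : ℝ × ℝ) :
    reconstruct dt dx (fun n j => w n j + z n j) p =
      reconstruct dt dx w p + reconstruct dt dx z p := by
  unfold reconstruct
  split_ifs <;> simp

variable {φ : ℝ → ℝ} {lam s : ℝ}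

theorem kineticStar_add (φ : ℝ → ℝ) (lam s : ℝ) (m : ℝ × ℝ) :
    kineticStar φ lam s 1 m + kineticStar φ lam s (-1) m = m.1 := by
  unfold kineticStar kinetic kineticEq
  ring

/-- The scheme in weak form, with difference quotients along the characteristics. -/
theorem weak_form_moments {u₀ : ℝ → ℝ} {dx C : ℝ} (hlam : 0 < lam) (hdx : 0 < dx)
    (hk : ∀ e ∈ ({1, -1} : Set ℝ), ∀ n j, |kinetic lam e (moments φ u₀ lam s dx n j)| ≤ C)
    (hks : ∀ e ∈ ({1, -1} : Set ℝ), ∀ n j, |kineticStar φ lam s e (moments φ u₀ lam s dx n j)| ≤ C)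
    {ψ : ℝ × ℝ → ℝ} (hψ : Continuous ψ) (hc : HasCompactSupport ψ) :
    (∫ p, reconstruct (dx / lam) dx
        (fun n j => kineticStar φ lam s 1 (moments φ u₀ lam s dx n j)) p *
        ((dx / lam)⁻¹ * (ψ (p + (dx / lam) • ((1, lam) : ℝ × ℝ)) - ψ p))) +
      (∫ p, reconstruct (dx / lam) dx
        (fun n j => kineticStar φ lam s (-1) (moments φ u₀ lam s dx n j)) p *
        ((dx / lam)⁻¹ * (ψ (p + (dx / lam) • ((1, -lam) : ℝ × ℝ)) - ψ p))) +
      (dx / lam)⁻¹ * ∫ p in {p : ℝ × ℝ | p.1 < dx / lam}, uDelta φ u₀ lam s dx p * ψ p = 0 := by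
  set m := moments φ u₀ lam s dx with hm
  set dt := dx / lam with hdt'
  have hdt : 0 < dt := by positivity
  let R : ℝ → ℝ × ℝ → ℝ := fun e => reconstruct dt dx fun n j => kinetic lam e (m n j)
  let Z : ℝ → ℝ × ℝ → ℝ := fun e => reconstruct dt dx fun n j => kineticStar φ lam s e (m n j)
  have hv1 : dt • ((1, lam) : ℝ × ℝ) = (dt, ((1 : ℤ) : ℝ) * dx) := by
    ext <;> simp [hdt']; field_simp
  have hv2 : dt • ((1, -lam) : ℝ × ℝ) = (dt, ((-1 : ℤ) : ℝ) * dx) := by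
    ext <;> simp [hdt']; field_simp
  have t1 := integral_reconstruct_transport hdt hdx 1 (hk 1 (by simp))
    (z := fun n j => kineticStar φ lam s 1 (m n j)) (fun n j => by
      have := kinetic_schemeStep_right φ hlam s (m n) (j + 1)
      rwa [add_sub_cancel_right] at this) hψ hc
  have t2 := integral_reconstruct_transport hdt hdx (-1) (hk (-1) (by simp))
    (z := fun n j => kineticStar φ lam s (-1) (m n j)) (fun n j => by
      have := kinetic_schemeStep_left φ hlam s (m n) (j + -1)
      rwa [neg_add_cancel_right] at this) hψ hc
  rw [← hv1] at t1
  rw [← hv2] at t2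
  have iR : ∀ e ∈ ({1, -1} : Set ℝ), Integrable fun p => R e p * ψ p := fun e he =>
    integrable_mul_of_abs_le (measurable_reconstruct _ _ _) (abs_reconstruct_le (hk e he)) hψ hc
  have iZ : ∀ e ∈ ({1, -1} : Set ℝ), Integrable fun p => Z e p * ψ p := fun e he =>
    integrable_mul_of_abs_le (measurable_reconstruct _ _ _) (abs_reconstruct_le (hks e he)) hψ hc
  have iZ' : ∀ e ∈ ({1, -1} : Set ℝ), ∀ v : ℝ × ℝ, Integrable fun p => Z e p * ψ (p + v) :=
    fun e he v => integrable_mul_of_abs_le (measurable_reconstruct _ _ _)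
      (abs_reconstruct_le (hks e he)) (η := fun p => ψ (p + v)) (by fun_prop)
      (hc.comp_homeomorph (Homeomorph.addRight v))
  have hU : ∀ p, uDelta φ u₀ lam s dx p = R 1 p + R (-1) p := fun p => by
    simp only [R]
    rw [← reconstruct_add]
    simp only [kinetic_add]
    rfl
  -- Relaxation conserves u. This cancels the terms containing unshifted ψ.
  have hRZ : ∀ p, R 1 p + R (-1) p = Z 1 p + Z (-1) p := fun p => by
    simp only [R, Z]
    rw [← reconstruct_add, ← reconstruct_add]
    simp only [kinetic_add, kineticStar_add]
  have q : ∀ e ∈ ({1, -1} : Set ℝ), ∀ v : ℝ × ℝ, ∫ p, Z e p * (dt⁻¹ * (ψ (p + v) - ψ p)) =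
      dt⁻¹ * ((∫ p, Z e p * ψ (p + v)) - ∫ p, Z e p * ψ p) := fun e he v => by
    rw [← integral_sub (iZ' e he v) (iZ e he), ← integral_const_mul]
    exact integral_congr_ae (ae_of_all _ fun p => by ring)
  rw [q 1 (by simp), q (-1) (by simp), t1, t2]
  simp only [hU, add_mul]
  rw [integral_add (iR 1 (by simp)).integrableOn (iR (-1) (by simp)).integrableOn]
  have hsum : (∫ p, R 1 p * ψ p) + ∫ p, R (-1) p * ψ p =
      (∫ p, Z 1 p * ψ p) + ∫ p, Z (-1) p * ψ p := by
    rw [← integral_add (iR 1 (by simp)) (iR (-1) (by simp)),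
      ← integral_add (iZ 1 (by simp)) (iZ (-1) (by simp))]
    simp only [← add_mul, hRZ]
  simp only [R] at hsum ⊢
  linear_combination dt⁻¹ * hsum

/-- The substitution t = dt τ turns the mean over a shrinking layer into an integral over the fixed
interval [0, 1], ready for dominated convergence. -/
theorem integral_first_step {u₀ : ℝ → ℝ} {dx C : ℝ} (hlam : 0 < lam) (hdx : 0 < dx)
    (hC : ∀ n j, |(moments φ u₀ lam s dx n j).1| ≤ C)
    {ψ : ℝ × ℝ → ℝ} (hψ : Continuous ψ) (hc : HasCompactSupport ψ) :
    (dx / lam)⁻¹ * ∫ p in {p : ℝ × ℝ | p.1 < dx / lam}, uDelta φ u₀ lam s dx p * ψ p =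
      ∫ τ in (0 : ℝ)..1, ∫ x, (initialMoments φ u₀ dx ⌊x / dx⌋).1 * ψ (dx / lam * τ, x) := by
  set dt := dx / lam with hdt'
  have hdt : 0 < dt := by positivity
  have hint : Integrable fun p => uDelta φ u₀ lam s dx p * ψ p :=
    integrable_mul_of_abs_le (measurable_reconstruct _ _ _) (abs_reconstruct_le hC) hψ hc
  have hS : MeasurableSet {p : ℝ × ℝ | p.1 < dt} :=
    measurableSet_lt measurable_fst measurable_const
  have e1 : ∫ p in {p : ℝ × ℝ | p.1 < dt}, uDelta φ u₀ lam s dx p * ψ p =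
      ∫ p in Ico 0 dt ×ˢ univ, uDelta φ u₀ lam s dx p * ψ p := by
    refine setIntegral_eq_of_subset_of_forall_sdiff_eq_zero hS (fun p hp => hp.1.2) fun p hp => ?_
    have hneg : p.1 < 0 := by
      by_contra h0
      exact hp.2 ⟨⟨not_lt.1 h0, hp.1⟩, mem_univ _⟩
    rw [uDelta, reconstruct_of_neg hneg, zero_mul]
  rw [e1, Measure.volume_eq_prod, setIntegral_prod _ (by
    rw [← Measure.volume_eq_prod]; exact hint.integrableOn)]
  have e2 : ∀ t ∈ Ico 0 dt, ∫ x in univ, uDelta φ u₀ lam s dx (t, x) * ψ (t, x) =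
      ∫ x, (initialMoments φ u₀ dx ⌊x / dx⌋).1 * ψ (t, x) := fun t ht => by
    rw [setIntegral_univ]
    have h0 : ⌊t / dt⌋₊ = 0 := Nat.floor_eq_zero.2 ((div_lt_one hdt).2 ht.2)
    simp only [uDelta, reconstruct, ht.1, if_true, ← hdt', h0, moments]
  rw [setIntegral_congr_fun measurableSet_Ico e2, integral_Ico_eq_integral_Ioc,
    ← intervalIntegral.integral_of_le hdt.le]
  have := intervalIntegral.integral_comp_mul_left (a := 0) (b := 1)
    (fun t => ∫ x, (initialMoments φ u₀ dx ⌊x / dx⌋).1 * ψ (t, x)) hdt.ne'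
  rw [this, mul_zero, mul_one, smul_eq_mul]

theorem tendsto_first_step {u₀ : ℝ → ℝ} {a : ℕ → ℝ → ℝ} {b : ℕ → ℝ} {C : ℝ}
    (ham : ∀ k, Measurable (a k)) (haC : ∀ k x, |a k x| ≤ C)
    (ha : ∀ᵐ x, Tendsto (fun k => a k x) atTop (𝓝 (u₀ x))) (hb : Tendsto b atTop (𝓝 0))
    {ψ : ℝ × ℝ → ℝ} (hψ : Continuous ψ) (hc : HasCompactSupport ψ) :
    Tendsto (fun k => ∫ τ in (0 : ℝ)..1, ∫ x, a k x * ψ (b k * τ, x)) atTop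
      (𝓝 (∫ x, u₀ x * ψ (0, x))) := by
  obtain ⟨R, hR0, hR⟩ := exists_norm_bound_of_hasCompactSupport hc
  obtain ⟨K, hK⟩ := hψ.bounded_above_of_compact_support hc
  have hC0 : 0 ≤ C := (abs_nonneg _).trans (haC 0 0)
  have hK0 : 0 ≤ K := (norm_nonneg _).trans (hK 0)
  let B : ℝ → ℝ := (Icc (-R) R).indicator fun _ => C * K
  have hB : Integrable B := by
    rw [integrable_indicator_iff measurableSet_Icc]
    exact integrableOn_const (by simp)
  have hle : ∀ k t x, ‖a k x * ψ (t, x)‖ ≤ B x := fun k t x => by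
    by_cases hx : x ∈ Icc (-R) R
    · simp only [B, indicator_of_mem hx, norm_mul]
      exact mul_le_mul (haC k x) (hK _) (norm_nonneg _) hC0
    · have : R < ‖(t, x)‖ := by
        refine lt_of_lt_of_le ?_ (norm_snd_le (t, x))
        rw [Real.norm_eq_abs]
        by_contra hcon
        exact hx (abs_le.1 (not_lt.1 hcon))
      simp [B, indicator_of_notMem hx, hR _ this]
  have hinner : ∀ τ : ℝ, Tendsto (fun k => ∫ x, a k x * ψ (b k * τ, x)) atTop
      (𝓝 (∫ x, u₀ x * ψ (0, x))) := fun τ => by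
    refine tendsto_integral_of_dominated_convergence B (fun k => ?_) hB
      (fun k => ae_of_all _ fun x => hle k _ x) ?_
    · exact ((ham k).mul (Continuous.measurable (by fun_prop))).aestronglyMeasurable
    · filter_upwards [ha] with x hx
      refine hx.mul ((hψ.tendsto (0, x)).comp ?_)
      refine Tendsto.prodMk_nhds ?_ tendsto_const_nhds
      simpa using hb.mul_const τ
  have h1 : ∫ x, u₀ x * ψ (0, x) = ∫ _ in (0 : ℝ)..1, ∫ x, u₀ x * ψ (0, x) := by simp
  rw [h1]
  refine intervalIntegral.tendsto_integral_filter_of_dominated_convergence (fun _ => ∫ x, B x)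
    (Eventually.of_forall fun k => ?_) (Eventually.of_forall fun k => ?_) (by simp)
    (ae_of_all _ fun τ _ => hinner τ)
  · have : StronglyMeasurable fun q : ℝ × ℝ => a k q.2 * ψ (b k * q.1, q.2) :=
      (((ham k).comp measurable_snd).mul (Continuous.measurable (by fun_prop))).stronglyMeasurable
    exact this.integral_prod_right'.aestronglyMeasurable
  · refine ae_of_all _ fun τ _ => ?_
    exact norm_integral_le_of_norm_le hB (ae_of_all _ fun x => hle k _ x)

end WeakForm

/-! ### Convergence -/

section Convergence

/-- Compactness for sequences of step functions with uniform variation bounds. -/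
theorem exists_subseq_reconstruct {lam C : ℝ} (hlam : 0 < lam) {dx : ℕ → ℝ} (hdx : ∀ k, 0 < dx k)
    {w : ℕ → ℕ → ℤ → ℝ} (hC : ∀ k n j, |w k n j| ≤ C) {V : ℝ≥0∞} (hV : V ≠ ⊤)
    (hw : ∀ k n, ∑' j, ENNReal.ofReal |w k n (j + 1) - w k n j| ≤ V)
    (hw' : ∀ k n, ∑' j, ENNReal.ofReal |w k (n + 1) j - w k n j| ≤ V) :
    ∃ κ : ℕ → ℕ, StrictMono κ ∧ ∃ G : ℝ × ℝ → ℝ, Measurable G ∧ (∀ p, |G p| ≤ C) ∧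
      ∀ᵐ p, Tendsto (fun k => reconstruct (dx (κ k) / lam) (dx (κ k)) (w (κ k)) p) atTop
        (𝓝 (G p)) :=
  exists_subseq_ae_tendsto (g := fun k => reconstruct (dx k / lam) (dx k) (w k))
    (fun _ => measurable_reconstruct _ _ _) (fun k => abs_reconstruct_le (hC k))
    (fun _ _ hp => reconstruct_of_neg hp) (A := fun T => ENNReal.ofReal ((1 + lam) * T) * V)
    (fun _ => ENNReal.mul_ne_top ENNReal.ofReal_ne_top hV)
    fun _ hT m k => lintegral_reconstruct_sub_le (hdx k) hlam hT (hw k) (hw' k)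
      measurableSet_Ico subset_rfl (measurable_latticePoint m) (measurable_latticePoint m)
      (fun _ ht => latticePoint_nonneg m ht.1) (fun t _ => latticePoint_le m t)
      (fun t _ => sub_le_latticePoint m t) (latticePoint_le m) (sub_le_latticePoint m)

/-- The sampling estimate with the exact translates t - b or x - b as sample points is a translation
estimate uniform in the mesh, hence valid for the limit. -/
theorem memBV2_of_ae_tendsto_reconstruct {lam C : ℝ} (hlam : 0 < lam) {dx : ℕ → ℝ}
    (hdx : ∀ k, 0 < dx k)
    {w : ℕ → ℕ → ℤ → ℝ} {V : ℝ≥0∞} (hV : V ≠ ⊤)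
    (hw : ∀ k n, ∑' j, ENNReal.ofReal |w k n (j + 1) - w k n j| ≤ V)
    (hw' : ∀ k n, ∑' j, ENNReal.ofReal |w k (n + 1) j - w k n j| ≤ V)
    {G : ℝ × ℝ → ℝ} (hG : Measurable G) (hGC : ∀ p, |G p| ≤ C)
    (h : ∀ᵐ p, Tendsto (fun k => reconstruct (dx k / lam) (dx k) (w k) p) atTop (𝓝 (G p)))
    {T : ℝ} (hT : 0 < T) : MemBV2 (strip T) G := by
  have hsub : ∀ b : ℝ, 0 < b → Ico b T ⊆ Ico 0 T := fun b hb => Ico_subset_Ico_left hb.le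
  refine memBV2_of_translation hG hGC (A := ENNReal.ofReal ((1 + lam) * T) * V)
    (ENNReal.mul_ne_top ENNReal.ofReal_ne_top hV) (fun b hb => ?_) (fun b hb => ?_)
  · refine lintegral_translate_le_of_ae_tendsto (fun k => measurable_reconstruct _ _ _) h _ _
      fun k => ?_
    have := lintegral_reconstruct_sub_le (h := b) (hdx k) hlam hT.le (hw k) (hw' k)
      measurableSet_Ico (hsub b hb) (r := fun t => t - b) (y := fun x => x)
      (by fun_prop) (by fun_prop) (fun t ht => sub_nonneg.2 ht.1) (fun t _ => by linarith)
      (fun t _ => le_rfl) (fun x => le_rfl) (fun x => by linarith)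
    refine le_trans (le_of_eq (lintegral_congr fun p => ?_)) this
    congr 3
    ext <;> simp
  · refine lintegral_translate_le_of_ae_tendsto (fun k => measurable_reconstruct _ _ _) h _ _
      fun k => ?_
    have := lintegral_reconstruct_sub_le (h := b) (hdx k) hlam hT.le (hw k) (hw' k)
      measurableSet_Ico (hsub b hb) (r := fun t => t) (y := fun x => x - b)
      (by fun_prop) (by fun_prop) (fun t ht => hb.le.trans ht.1) (fun t _ => le_rfl)
      (fun t _ => by linarith) (fun x => by linarith) (fun x => le_rfl)
    refine le_trans (le_of_eq (lintegral_congr fun p => ?_)) this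
    congr 3
    ext <;> simp

/-- Limits of step functions whose `ℓ¹` distance stays bounded agree for positive times. -/
theorem ae_eq_of_tsum_le {dt dx : ℕ → ℝ} (hdx : ∀ k, 0 < dx k)
    (hdx0 : Tendsto dx atTop (𝓝 0)) {w z : ℕ → ℕ → ℤ → ℝ} {D : ℝ≥0∞} (hD : D ≠ ⊤)
    (hwz : ∀ k n, ∑' j, ENNReal.ofReal |w k n j - z k n j| ≤ D) {g h : ℝ × ℝ → ℝ}
    (hg : Measurable g) (hh : Measurable h)
    (hw : ∀ᵐ p, Tendsto (fun k => reconstruct (dt k) (dx k) (w k) p) atTop (𝓝 (g p)))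
    (hz : ∀ᵐ p ∂volume.restrict halfPlane,
      Tendsto (fun k => reconstruct (dt k) (dx k) (z k) p) atTop (𝓝 (h p))) :
    ∀ᵐ p ∂volume.restrict halfPlane, g p = h p := by
  have hz' := (ae_restrict_iff' measurableSet_halfPlane).1 hz
  have hmain : ∀ T : ℕ, ∀ᵐ p : ℝ × ℝ, p ∈ Ico (0 : ℝ) T ×ˢ (univ : Set ℝ) → g p = h p := by
    intro T
    have hS : MeasurableSet (Ico (0 : ℝ) T ×ˢ (univ : Set ℝ)) :=
      measurableSet_Ico.prod MeasurableSet.univ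
    have hbound : ∀ k, ∫⁻ p in Ico (0 : ℝ) T ×ˢ univ,
        ‖reconstruct (dt k) (dx k) (w k) p - reconstruct (dt k) (dx k) (z k) p‖ₑ ≤
          ENNReal.ofReal (dx k) * (D * ENNReal.ofReal T) := fun k => by
      have m1 := measurable_reconstruct (dt k) (dx k) (w k)
      have m2 := measurable_reconstruct (dt k) (dx k) (z k)
      rw [Measure.volume_eq_prod, ← Measure.prod_restrict, Measure.restrict_univ,
        lintegral_prod _ (by fun_prop)]
      have h1 : ∀ t ∈ Ico (0 : ℝ) T, ∫⁻ x, ‖reconstruct (dt k) (dx k) (w k) (t, x) -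
          reconstruct (dt k) (dx k) (z k) (t, x)‖ₑ ≤ ENNReal.ofReal (dx k) * D := fun t ht => by
        refine le_trans ?_ (mul_le_mul_right (hwz k ⌊t / dt k⌋₊) _)
        refine le_trans (le_of_eq (lintegral_congr fun x => ?_)) (lintegral_floor_le (hdx k) _)
        simp only [reconstruct, ht.1, if_true]
        rw [← Real.norm_eq_abs, ofReal_norm]
      refine (setLIntegral_mono' measurableSet_Ico h1).trans ?_
      rw [lintegral_const, Measure.restrict_apply_univ, Real.volume_Ico, sub_zero, mul_assoc]
    have hlim0 : Tendsto (fun k => ENNReal.ofReal (dx k) * (D * ENNReal.ofReal T)) atTop (𝓝 0) := by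
      have := ENNReal.Tendsto.mul_const (ENNReal.tendsto_ofReal hdx0)
        (Or.inr (ENNReal.mul_ne_top hD (ENNReal.ofReal_ne_top (r := (T : ℝ)))))
      rwa [ENNReal.ofReal_zero, zero_mul] at this
    have hzero : ∫⁻ p in Ico (0 : ℝ) T ×ˢ univ, ‖g p - h p‖ₑ = 0 := by
      refine le_antisymm ?_ bot_le
      calc _ = ∫⁻ p in Ico (0 : ℝ) T ×ˢ univ, liminf (fun k => ‖reconstruct (dt k) (dx k) (w k) p -
              reconstruct (dt k) (dx k) (z k) p‖ₑ) atTop := by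
            refine lintegral_congr_ae ((ae_restrict_iff' hS).2 ?_)
            filter_upwards [hw, hz'] with p h1 h2 hp
            exact ((h1.sub (h2 ⟨hp.1.1, mem_univ _⟩)).enorm).liminf_eq.symm
        _ ≤ liminf (fun k => ∫⁻ p in Ico (0 : ℝ) T ×ˢ univ, ‖reconstruct (dt k) (dx k) (w k) p -
              reconstruct (dt k) (dx k) (z k) p‖ₑ) atTop :=
            lintegral_liminf_le fun k =>
              ((measurable_reconstruct _ _ _).sub (measurable_reconstruct _ _ _)).enorm
        _ ≤ liminf (fun k => ENNReal.ofReal (dx k) * (D * ENNReal.ofReal T)) atTop :=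
            liminf_le_liminf (Eventually.of_forall hbound)
        _ = 0 := hlim0.liminf_eq
    rw [lintegral_eq_zero_iff (by exact (hg.sub hh).enorm)] at hzero
    filter_upwards [(ae_restrict_iff' hS).1 hzero] with p hp hpS
    exact sub_eq_zero.1 (enorm_eq_zero.1 (hp hpS))
  rw [ae_restrict_iff' measurableSet_halfPlane]
  filter_upwards [ae_all_iff.2 hmain] with p hp hpH
  obtain ⟨n, hn⟩ := exists_nat_gt p.1
  exact hp n ⟨⟨hpH.1, hn⟩, mem_univ _⟩

/-- The restriction to t ≥ 0 matters: for t < 0 every reconstruction is 0, whereas F(0, 0) need not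
be. -/
theorem tendsto_reconstruct_comp {dt dx : ℕ → ℝ} {w z : ℕ → ℕ → ℤ → ℝ} {F : ℝ → ℝ → ℝ}
    (hF : Continuous fun q : ℝ × ℝ => F q.1 q.2) {p : ℝ × ℝ} (hp : p ∈ halfPlane) {a b : ℝ}
    (hw : Tendsto (fun k => reconstruct (dt k) (dx k) (w k) p) atTop (𝓝 a))
    (hz : Tendsto (fun k => reconstruct (dt k) (dx k) (z k) p) atTop (𝓝 b)) :
    Tendsto (fun k => reconstruct (dt k) (dx k) (fun n j => F (w k n j) (z k n j)) p) atTop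
      (𝓝 (F a b)) := by
  have h0 : 0 ≤ p.1 := hp.1
  simp only [reconstruct, h0, if_true] at hw hz ⊢
  exact (hF.tendsto (a, b)).comp (hw.prodMk_nhds hz)

theorem exists_bound_comp {φ : ℝ → ℝ} (hφ : Continuous φ) (C : ℝ) :
    ∃ D, ∀ x, |x| ≤ C → |φ x| ≤ D := by
  obtain ⟨D, hD⟩ := (isCompact_Icc (a := -C) (b := C)).exists_bound_of_continuousOn
    hφ.continuousOn
  exact ⟨D, fun x hx => hD x (abs_le.1 hx)⟩

/-- Limits of the scheme satisfy the weak form of the conservation law. -/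
theorem weak_solution_of_ae_tendsto {φ u₀ : ℝ → ℝ} (hφ : Continuous φ) {lam s : ℝ}
    (hlam : 0 < lam) {dx : ℕ → ℝ} (hdx : ∀ k, 0 < dx k) (hdx0 : Tendsto dx atTop (𝓝 0))
    (hu₀ : MemLp u₀ ⊤ volume) {C : ℝ}
    (hk : ∀ k, ∀ e ∈ ({1, -1} : Set ℝ), ∀ n j,
      |kinetic lam e (moments φ u₀ lam s (dx k) n j)| ≤ C)
    (hks : ∀ k, ∀ e ∈ ({1, -1} : Set ℝ), ∀ n j,
      |kineticStar φ lam s e (moments φ u₀ lam s (dx k) n j)| ≤ C)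
    (hC : ∀ k n j, |(moments φ u₀ lam s (dx k) n j).1| ≤ C)
    {u v : ℝ × ℝ → ℝ} (hum : Measurable u) (huC : ∀ p, |u p| ≤ C)
    (hu : ∀ᵐ p, Tendsto (fun k => uDelta φ u₀ lam s (dx k) p) atTop (𝓝 (u p)))
    (hv : ∀ᵐ p, Tendsto (fun k => vDelta φ u₀ lam s (dx k) p) atTop (𝓝 (v p)))
    (huv : ∀ᵐ p ∂volume.restrict halfPlane, v p = φ (u p)) : IsWeakSolution φ u₀ u := by
  refine ⟨memLp_top_of_abs_le hum huC, fun ψ hψ hc => ?_⟩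
  have hψ1 : ContDiff ℝ 1 ψ := hψ.of_le (by exact_mod_cast le_top)
  have hψc := hψ.continuous
  have hdt : ∀ k, 0 < dx k / lam := fun k => div_pos (hdx k) hlam
  have hdt0 : Tendsto (fun k => dx k / lam) atTop (𝓝 0) := by simpa using hdx0.div_const lam
  let Z : ℝ → ℕ → ℝ × ℝ → ℝ := fun e k => reconstruct (dx k / lam) (dx k)
    fun n j => kineticStar φ lam s e (moments φ u₀ lam s (dx k) n j)
  have hZlim : ∀ e, ∀ᵐ p ∂volume.restrict halfPlane,
      Tendsto (fun k => Z e k p) atTop (𝓝 (kineticEq φ lam e (u p))) := fun e => by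
    filter_upwards [ae_restrict_of_ae hu, ae_restrict_of_ae hv, huv,
      ae_restrict_mem measurableSet_halfPlane] with p h1 h2 h3 hp
    -- Since v = φ(u) in the limit, relaxation leaves the limit state unchanged.
    have h4 : kineticEq φ lam e (u p) = kineticStar φ lam s e (u p, v p) := by
      rw [h3]; unfold kineticStar kineticEq kinetic; ring
    rw [h4]
    exact tendsto_reconstruct_comp (F := fun a b => kineticStar φ lam s e (a, b))
      (by unfold kineticStar kinetic kineticEq; fun_prop) hp h1 h2
  have hDQ : ∀ e ∈ ({1, -1} : Set ℝ), Tendsto (fun k => ∫ p, Z e k p *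
      ((dx k / lam)⁻¹ * (ψ (p + (dx k / lam) • ((1, e * lam) : ℝ × ℝ)) - ψ p))) atTop
      (𝓝 (∫ p in halfPlane, kineticEq φ lam e (u p) * fderiv ℝ ψ p (1, e * lam))) := by
    intro e he
    refine (tendsto_integral_mul_difference_quotient (volume.restrict halfPlane) hψ1 hc
      (1, e * lam) hdt hdt0 (fun k => measurable_reconstruct _ _ _)
      (fun k => abs_reconstruct_le (hks k e he)) (hZlim e)).congr fun k => ?_
    refine setIntegral_eq_integral_of_forall_compl_eq_zero fun p hp => ?_
    have hneg : p.1 < 0 := by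
      by_contra h0
      exact hp ⟨not_lt.1 h0, mem_univ _⟩
    rw [reconstruct_of_neg hneg, zero_mul]
  have hfirst := tendsto_first_step (u₀ := u₀) (b := fun k => dx k / lam)
    (a := fun k x => (initialMoments φ u₀ (dx k) ⌊x / dx k⌋).1) (fun k => by
      have : Measurable fun j : ℤ => (initialMoments φ u₀ (dx k) j).1 := Measurable.of_discrete
      exact this.comp (Int.measurable_floor.comp (measurable_id.div_const _)))
    (fun k x => hC k 0 _) (ae_tendsto_initialMoments φ hu₀ hdx hdx0) hdt0 hψc hc
  have htotal := ((hDQ 1 (by simp)).add (hDQ (-1) (by simp))).add hfirst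
  simp only [one_mul, neg_one_mul] at htotal
  have hlimit := tendsto_nhds_unique (htotal.congr (f₂ := fun _ => 0) fun k => by
    have := weak_form_moments hlam (hdx k) (hk k) (hks k) hψc hc
    rwa [integral_first_step hlam (hdx k) (hC k) hψc hc] at this) tendsto_const_nhds
  refine Eq.trans ?_ hlimit
  congr 1
  have hk1 : ∀ e ∈ ({1, -1} : Set ℝ), ∀ v : ℝ × ℝ,
      IntegrableOn (fun p => kineticEq φ lam e (u p) * fderiv ℝ ψ p v) halfPlane := fun e _ v => by
    obtain ⟨B, hB⟩ := exists_bound_comp (φ := kineticEq φ lam e)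
      (by unfold kineticEq; fun_prop) C
    have hm : Continuous (kineticEq φ lam e) := by unfold kineticEq; fun_prop
    exact (integrable_mul_of_abs_le (hm.measurable.comp hum) (fun p => hB _ (huC p))
      ((hψ1.continuous_fderiv one_ne_zero).clm_apply continuous_const)
      (hc.fderiv_apply ℝ v)).integrableOn
  rw [← integral_add (hk1 1 (by simp) _) (hk1 (-1) (by simp) _)]
  refine integral_congr_ae (ae_of_all _ fun p => ?_)
  have hsplit : ∀ c : ℝ, fderiv ℝ ψ p (1, c) = partialT ψ p + c * partialX ψ p := fun c => by
    have : ((1, c) : ℝ × ℝ) = (1, 0) + c • (0, 1) := by ext <;> simp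
    rw [this, map_add, map_smul, smul_eq_mul]
    rfl
  -- Summing over e = ±1, the equilibria add up to u in front of ∂ₜψ, and λ times their difference
  -- gives φ(u) in front of ∂ₓψ.
  simp only [hsplit, kineticEq]
  field_simp
  ring

end Convergence

end D1Q2

end

/-! ### Assembly of the main theorem. -/

open D1Q2

theorem mainTheorem2 (φ : ℝ → ℝ) (hφ : ContDiff ℝ 1 φ)
    (u₀ : ℝ → ℝ) (hu₀ : MemLp u₀ ⊤ volume) (hu₀BV : D1Q2.MemBV1 univ u₀)
    (s : ℝ) (hs : s ∈ Ioc (0 : ℝ) 1)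
    (lam : ℝ) (hlam : 0 < lam) (hCFL : D1Q2.maxSpeed φ u₀ ≤ lam)
    (dx : ℕ → ℝ) (hdx : ∀ k, 0 < dx k) (hdx0 : Tendsto dx atTop (𝓝 0)) :
    ∃ κ : ℕ → ℕ, StrictMono κ ∧ ∃ u v : ℝ × ℝ → ℝ,
      MemLp u ⊤ (volume.restrict D1Q2.halfPlane) ∧
      MemLp v ⊤ (volume.restrict D1Q2.halfPlane) ∧
      (∀ T : ℝ, 0 < T → D1Q2.MemBV2 (D1Q2.strip T) u ∧ D1Q2.MemBV2 (D1Q2.strip T) v) ∧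
      D1Q2.TendstoL1Loc (fun k => D1Q2.uDelta φ u₀ lam s (dx (κ k))) u D1Q2.halfPlane ∧
      D1Q2.TendstoL1Loc (fun k => D1Q2.vDelta φ u₀ lam s (dx (κ k))) v D1Q2.halfPlane ∧
      D1Q2.IsWeakSolution φ u₀ u ∧
      ∀ᵐ p ∂(volume.restrict D1Q2.halfPlane), v p = φ (u p) := by
  have hV : totalVariation1 univ u₀ ≠ ⊤ := hu₀BV.2.ne
  have hM : ∀ ξ ∈ Icc (essInf u₀ volume) (essSup u₀ volume), |deriv φ ξ| ≤ lam := fun ξ hξ => by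
    -- A real supremum bounds its set only if the set is bounded above; continuity of φ' on a
    -- compact interval provides this.
    refine le_trans (le_csSup ?_ (mem_image_of_mem (fun ξ => |deriv φ ξ|) hξ)) hCFL
    exact (isCompact_Icc.image_of_continuousOn
      (hφ.continuous_deriv (by norm_num)).abs.continuousOn).bddAbove
  have hr := monotoneOn_kineticEq hφ hlam hM (e := 1) (by simp)
  have hl := monotoneOn_kineticEq hφ hlam hM (e := -1) (by simp)
  have h0 : ∀ k j, (initialMoments φ u₀ (dx k) j).1 ∈ Icc (essInf u₀ volume) (essSup u₀ volume) :=
    fun k j => initialMoments_mem_Icc φ hu₀ (essInf_le_ae_le_essSup hu₀) (hdx k) j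
  have hTV := fun k => tsum_initialMoments_sub_le φ hu₀ hu₀BV.2 (hdx k)
  have hinv : ∀ k n j, moments φ u₀ lam s (dx k) n j ∈ invariantRegion φ lam _ _ :=
    fun k n => moments_mem_invariantRegion hlam hs hr hl (h0 k) n
  have hspace := fun k => tsum_kineticDist_space_le hlam hs hr hl (h0 k) (hTV k)
  have htime := fun k => tsum_kineticDist_time_le hlam hs hr hl (h0 k) (hTV k)
  have hdefect := fun k => tsum_equilibrium_defect_le hlam hs hr hl (h0 k) (hTV k)
  obtain ⟨C, hC⟩ := exists_bound_invariantRegion hlam hs hr hl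
  have hu1 : ∀ k n, ∑' j, ENNReal.ofReal |(moments φ u₀ lam s (dx k) n (j + 1)).1 -
      (moments φ u₀ lam s (dx k) n j).1| ≤ totalVariation1 univ u₀ := fun k n =>
    (ENNReal.tsum_le_tsum fun j => ENNReal.ofReal_le_ofReal (abs_fst_sub_le lam _ _)).trans
      (hspace k n)
  have hu2 : ∀ k n, ∑' j, ENNReal.ofReal |(moments φ u₀ lam s (dx k) (n + 1) j).1 -
      (moments φ u₀ lam s (dx k) n j).1| ≤ totalVariation1 univ u₀ := fun k n =>
    (ENNReal.tsum_le_tsum fun j => ENNReal.ofReal_le_ofReal (abs_fst_sub_le lam _ _)).trans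
      (htime k n)
  have hv1 : ∀ k n, ∑' j, ENNReal.ofReal |(moments φ u₀ lam s (dx k) n (j + 1)).2 -
      (moments φ u₀ lam s (dx k) n j).2| ≤ ENNReal.ofReal lam * totalVariation1 univ u₀ :=
    fun k n => (tsum_abs_snd_sub_le hlam _ _).trans (mul_le_mul_right (hspace k n) _)
  have hv2 : ∀ k n, ∑' j, ENNReal.ofReal |(moments φ u₀ lam s (dx k) (n + 1) j).2 -
      (moments φ u₀ lam s (dx k) n j).2| ≤ ENNReal.ofReal lam * totalVariation1 univ u₀ :=
    fun k n => (tsum_abs_snd_sub_le hlam _ _).trans (mul_le_mul_right (htime k n) _)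
  have hV' : ENNReal.ofReal lam * totalVariation1 univ u₀ ≠ ⊤ :=
    ENNReal.mul_ne_top ENNReal.ofReal_ne_top hV
  obtain ⟨κ₁, hκ₁, u, hum, huC, hu⟩ := exists_subseq_reconstruct hlam hdx
    (w := fun k n j => (moments φ u₀ lam s (dx k) n j).1) (fun k n j => (hC _ (hinv k n j)).1)
    hV hu1 hu2
  -- The second extraction is made along the first, so that u and v converge along a common
  -- subsequence.
  obtain ⟨κ₂, hκ₂, v, hvm, hvC, hv⟩ := exists_subseq_reconstruct hlam (fun k => hdx (κ₁ k))
    (w := fun k n j => (moments φ u₀ lam s (dx (κ₁ k)) n j).2)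
    (fun k n j => (hC _ (hinv (κ₁ k) n j)).2.1) hV' (fun k => hv1 (κ₁ k)) (fun k => hv2 (κ₁ k))
  have hκ := hκ₁.comp hκ₂
  have hu' : ∀ᵐ p, Tendsto (fun k => uDelta φ u₀ lam s (dx ((κ₁ ∘ κ₂) k)) p) atTop (𝓝 (u p)) :=
    hu.mono fun p hp => hp.comp hκ₂.tendsto_atTop
  have hv' : ∀ᵐ p, Tendsto (fun k => vDelta φ u₀ lam s (dx ((κ₁ ∘ κ₂) k)) p) atTop (𝓝 (v p)) := hv
  have hdx' : ∀ k, 0 < dx ((κ₁ ∘ κ₂) k) := fun k => hdx _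
  have hdx0' : Tendsto (fun k => dx ((κ₁ ∘ κ₂) k)) atTop (𝓝 0) := hdx0.comp hκ.tendsto_atTop
  have huv : ∀ᵐ p ∂volume.restrict halfPlane, v p = φ (u p) := by
    refine ae_eq_of_tsum_le (dt := fun k => dx ((κ₁ ∘ κ₂) k) / lam) hdx' hdx0'
      (w := fun k n j => (moments φ u₀ lam s (dx ((κ₁ ∘ κ₂) k)) n j).2)
      (z := fun k n j => φ (moments φ u₀ lam s (dx ((κ₁ ∘ κ₂) k)) n j).1)
      (ENNReal.mul_ne_top ENNReal.ofReal_ne_top (ENNReal.add_ne_top.2 ⟨hV, hV⟩))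
      (fun k n => hdefect _ n) hvm (hφ.continuous.measurable.comp hum) hv' ?_
    filter_upwards [ae_restrict_of_ae hu', ae_restrict_mem measurableSet_halfPlane] with p hp hpH
    exact tendsto_reconstruct_comp (F := fun a _ => φ a)
      (hφ.continuous.comp continuous_fst) hpH hp hp
  refine ⟨κ₁ ∘ κ₂, hκ, u, v, memLp_top_of_abs_le hum huC, memLp_top_of_abs_le hvm hvC,
    fun T hT => ⟨?_, ?_⟩, ?_, ?_, ?_, huv⟩
  · exact memBV2_of_ae_tendsto_reconstruct hlam hdx' hV (fun k => hu1 _) (fun k => hu2 _) hum huC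
      hu' hT
  · exact memBV2_of_ae_tendsto_reconstruct hlam hdx' hV' (fun k => hv1 _) (fun k => hv2 _) hvm hvC
      hv' hT
  · exact tendstoL1Loc_of_ae_tendsto (fun k => measurable_reconstruct _ _ _) hum
      (fun k => abs_reconstruct_le fun n j => (hC _ (hinv _ n j)).1) huC hu' _
  · exact tendstoL1Loc_of_ae_tendsto (fun k => measurable_reconstruct _ _ _) hvm
      (fun k => abs_reconstruct_le fun n j => (hC _ (hinv _ n j)).2.1) hvC hv' _
  · exact weak_solution_of_ae_tendsto hφ.continuous hlam hdx' hdx0' hu₀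
      (fun k e he n j => ((hC _ (hinv _ n j)).2.2 e he).1)
      (fun k e he n j => ((hC _ (hinv _ n j)).2.2 e he).2)
      (fun k n j => (hC _ (hinv _ n j)).1) hum huC hu' hv' huv
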